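/- Let $\mathrm{Isom}(\mathbb R^2)$ be the group of maps $g=\tau_{v(g)}\circ\rho_{\theta(g)}$ of $\mathbb R^2\simeq\mathbb C$, $g(x)=e^{i\theta(g)}x+g(0)$, where $\theta(g)$ is the angle of rotation and $v(g)=g(0)$. Let $\mu$ be a probability measure on $\mathrm{Isom}(\mathbb R^2)$ with finite support which is symmetric (if $g$ has law $\mu$, then so has $g^{-1}$) and satisfies $\mathbb E_{g\sim\mu}\, g(0)=0$, and suppose that some $g\in\operatorname{supp}\mu$ satisfies $\cos\theta(g)\in\mathbb Q\setminus\frac12\mathbb Z$. Let $g_1,g_2,\dots$ be independent with law $\mu$, let $Y_N=(g_1g_2\cdots g_N)(0)$, and let $\sigma\ge 0$ be given by $\sigma^2=\frac12\mathbb E|g_1(0)|^2$. Then there are constants $c,C>0$, depending only on $\mu$, such that for all integers $N\ge 2$, all $x_0\in\mathbb R^2$ and all $r>\exp\bigl(-cN^{1/3}/(\log N)^2\bigr)$, $$\bigl|\mathbb P(Y_N\in B_r(x_0))-\mathbb P(\sigma\sqrt N\,Z_1\in B_r(x_0))\bigr|\le C N^{-3/2}r^2,$$ where $Z_1$ is a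 standard Gaussian on $\mathbb R^2$ and $B_r(x_0)$ is the open ball of radius $r$ about $x_0$. -/

import Mathlib

open MeasureTheory ProbabilityTheory

noncomputable section

namespace PlaneWalk

/-- The group `Isom(ℝ²)` of maps `τ_v ∘ ρ_θ` (a rotation followed by a translation), with `ℝ²`
identified with `ℂ`, as a subgroup of the group of all isometries of `ℂ` under composition. -/
def rigidMotions : Subgroup (ℂ ≃ᵢ ℂ) where
  carrier := {g | ∃ θ : ℝ, ∀ x : ℂ, g x = Complex.exp (θ * Complex.I) * x + g 0}
  one_mem' := ⟨0, fun x => by simp⟩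
  mul_mem' := by
    rintro g h ⟨α, hα⟩ ⟨β, hβ⟩
    refine ⟨α + β, fun x => ?_⟩
    rw [IsometryEquiv.mul_apply, IsometryEquiv.mul_apply, hα (h x), hβ x, hα (h 0)]
    push_cast
    rw [add_mul, Complex.exp_add]
    ring
  inv_mem' := by
    rintro g ⟨α, hα⟩
    have key : ∀ x : ℂ, g⁻¹ x = Complex.exp (-α * Complex.I) * (x - g 0) := fun x => by
      apply g.injective
      rw [IsometryEquiv.apply_inv_self, hα, ← mul_assoc, ← Complex.exp_add]
      simp
    refine ⟨-α, fun x => ?_⟩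
    rw [key x, key 0]
    push_cast
    ring

/-- The translation part `v(g) = g(0)`. -/
def trans (g : rigidMotions) : ℂ := (g : ℂ ≃ᵢ ℂ) 0

/-- The rotation angle `θ(g)`, normalised to lie in `(-π, π]`; note `e^{iθ(g)} = g(1) - g(0)`. -/
def angle (g : rigidMotions) : ℝ := Complex.arg ((g : ℂ ≃ᵢ ℂ) 1 - (g : ℂ ≃ᵢ ℂ) 0)

/-- The defining property of `θ(g)` and `v(g)`: `g = τ_{v(g)} ∘ ρ_{θ(g)}`. -/
theorem apply_eq (g : rigidMotions) (x : ℂ) :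
    (g : ℂ ≃ᵢ ℂ) x = Complex.exp (angle g * Complex.I) * x + trans g := by
  obtain ⟨g, θ, hθ⟩ := g
  have h1 : g 1 - g 0 = Complex.exp (θ * Complex.I) := by rw [hθ 1]; ring
  have h2 : Complex.exp (((g 1 - g 0).arg : ℂ) * Complex.I) = g 1 - g 0 := by
    have h := Complex.norm_mul_exp_arg_mul_I (g 1 - g 0)
    have hn : ‖g 1 - g 0‖ = 1 := by rw [h1, Complex.norm_exp_ofReal_mul_I]
    rwa [hn, Complex.ofReal_one, one_mul] at h
  simp only [angle, trans]
  rw [h2, h1]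
  exact hθ x

/-- `μ` is symmetric: if `g` has law `μ`, so has `g⁻¹`. -/
def IsSymmetric (μ : PMF rigidMotions) : Prop := μ.map (fun g => g⁻¹) = μ

/-- The law of `g₁ g₂ ⋯ g_N`, where `g₁, …, g_N` are independent with law `μ`. -/
def productLaw (μ : PMF rigidMotions) : ℕ → PMF rigidMotions
  | 0 => PMF.pure 1
  | N + 1 => (productLaw μ N).bind fun h => μ.map fun g => h * g

/-- The law of `Y_N = (g₁ g₂ ⋯ g_N)(0)`. -/
def walkLaw (μ : PMF rigidMotions) (N : ℕ) : PMF ℂ := (productLaw μ N).map trans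

/-- The drift `𝔼 g₁(0)`; a finite sum when `μ` has finite support. -/
def drift (μ : PMF rigidMotions) : ℂ := ∑' g, (μ g).toReal • trans g

/-- `σ`, where `σ² = ½ 𝔼 |g₁(0)|²`. -/
def sigma (μ : PMF rigidMotions) : ℝ :=
  Real.sqrt (1 / 2 * ∑' g, (μ g).toReal * ‖trans g‖ ^ 2)

end PlaneWalk

end

/-! For each radius `s`, the group acts unitarily on functions on the circle (`act s`). The
characteristic function of `Y_N` on the circle of radius `s` is `T_s ^ N` applied to the constant
`1`, where `T_s = avg s` averages the action over one step (`charFun_walkLaw`). The theorem is thus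
a statement about the operators `T_s`, transferred to balls by Fourier inversion.

The main point is a spectral gap (`exists_spectral_gap`): `‖T_s‖ ≤ exp (-c s²)` for small `s`, and
`‖T_s‖ ≤ exp (-c / (1 + log R)²)` for `s₀ ≤ s ≤ R`. If `T_s` almost preserves the norm of `f`, then
all quotients of two steps almost fix `f`. Words in these quotients include a rotation by `z =
e^{2iθ}` and, through a commutator, a nonzero translation `v`. The number `z` satisfies `B z² = A z
- B` with `B ≥ 2` coprime to `A`. Hence `z^k / B^k` lies in `ℤ[z]` and has an expansion with `O(k)`
bounded digits, so a translation of length `|v| / B^k` is a word of length `O(k)`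
(`subadditive_contraction_le`) and moves `f` little. With `B^k` comparable to `s |v|`, the
translation and its rotation by `z` must move `f` by a fixed proportion of its norm. This gives a
gap of order `k⁻²`, that is `(log s)⁻²`.

At low frequency, `1 + s² · corrector` is an eigenvector of `T_s` up to `O(s³)`, with the eigenvalue
`exp (-σ² s² / 2)` of the Gaussian. The characteristic functions therefore differ by `O((N s³ + s²)
exp (-c N s²))` in mean square (`exists_l2_charDiff_le`), which integrates over the plane to
`O(N^{-3/2})`.

Finally both laws are smoothed at scale `δ = r / √N`. The Gaussian density is `O(1/N)`, so the edge
of the ball costs `O(r δ / N) = O(N^{-3/2} r²)`. Frequencies are cut at `R = exp (β N^{1/3})`: below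
`R` the gap wins over the area `R²`, beyond `R` the decay of the kernel wins over `δ⁻⁴`. If all
steps fix the origin, both laws are the point mass at `0`. -/

open MeasureTheory ProbabilityTheory

noncomputable section

namespace PlaneWalk

/-! ### Digit expansions in `ℤ[z]` and subadditive functions -/

section Digits

variable {L : ℂ → ℝ} {d : ℝ} {z : ℂ}

lemma subadditive_natCast_mul_le (hadd : ∀ x y, L (x + y) ≤ L x + L y)
    (h0 : L 0 = 0) (n : ℕ) (x : ℂ) : L (n * x) ≤ n * L x := by
  induction n with
  | zero => simp [h0]
  | succ n ih =>
    have := hadd (n * x) x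
    push_cast
    rw [add_mul, one_mul]
    linarith

lemma subadditive_intCast_mul_le (hadd : ∀ x y, L (x + y) ≤ L x + L y)
    (h0 : L 0 = 0) (hneg : ∀ x, L (-x) = L x) (n : ℤ) (x : ℂ) : L (n * x) ≤ |(n : ℝ)| * L x := by
  obtain ⟨m, rfl | rfl⟩ := n.eq_nat_or_neg
  · simpa using subadditive_natCast_mul_le hadd h0 m x
  · simpa [hneg] using subadditive_natCast_mul_le hadd h0 m x

/-- A residue of `n` modulo `B` that is at most `B` in absolute value and has a prescribed sign. -/
lemma exists_signed_residue (n : ℤ) {B : ℤ} (hB : 0 < B) (t : ℝ) :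
    ∃ q r : ℤ, n = r + B * q ∧ |r| ≤ B ∧ 0 ≤ r * t := by
  rcases le_total 0 t with ht | ht
  · refine ⟨n / B, n % B, (Int.emod_add_mul_ediv n B).symm, ?_, ?_⟩
    · rw [abs_of_nonneg (Int.emod_nonneg _ hB.ne')]
      exact (Int.emod_lt_of_pos _ hB).le
    · exact mul_nonneg (by exact_mod_cast Int.emod_nonneg _ hB.ne') ht
  · refine ⟨-((-n) / B), -((-n) % B), ?_, ?_, ?_⟩
    · have := Int.emod_add_mul_ediv (-n) B
      linarith
    · rw [abs_neg, abs_of_nonneg (Int.emod_nonneg _ hB.ne')]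
      exact (Int.emod_lt_of_pos _ hB).le
    · have : (0 : ℝ) ≤ ((-n % B : ℤ) : ℝ) := by exact_mod_cast Int.emod_nonneg _ hB.ne'
      push_cast
      nlinarith

/-- A digit of the same sign as `Re w` makes the cross term nonpositive, so the squared norm grows
by at most `B²` per digit. After `k` digits the norm is `O(√k)` rather than `O(k)` beyond its
initial value. -/
lemma norm_sub_intCast_sq_le {w : ℂ} {r B : ℤ} (hr : |r| ≤ B) (hs : 0 ≤ r * w.re) :
    ‖w - r‖ ^ 2 ≤ ‖w‖ ^ 2 + (B : ℝ) ^ 2 := by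
  have hr' : (r : ℝ) ^ 2 ≤ (B : ℝ) ^ 2 := by
    have : |(r : ℝ)| ≤ (B : ℝ) := by exact_mod_cast hr
    exact sq_le_sq' (by linarith [neg_abs_le (r : ℝ)]) ((le_abs_self _).trans this)
  rw [← Complex.normSq_eq_norm_sq, ← Complex.normSq_eq_norm_sq, Complex.normSq_apply,
    Complex.normSq_apply]
  simp only [Complex.sub_re, Complex.sub_im, Complex.intCast_re, Complex.intCast_im]
  nlinarith

open Polynomial in
-- As `z` is not real, both coefficients of `a z + b` are controlled by its absolute value. This
-- ends the digit expansion.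
lemma subadditive_aeval_le_of_natDegree_le_one (hadd : ∀ x y, L (x + y) ≤ L x + L y)
    (h0 : L 0 = 0) (hneg : ∀ x, L (-x) = L x) (hrot : ∀ x, L (z * x) ≤ L x + d)
    (hL : ∀ x, 0 ≤ L x) (hz : ‖z‖ = 1) (him : z.im ≠ 0)
    (P : ℤ[X]) (hP : P.natDegree ≤ 1) (x : ℂ) :
    L (aeval z P * x) ≤ (1 + 2 / |z.im|) * ‖aeval z P‖ * L x + d := by
  obtain ⟨a, b, rfl⟩ := exists_eq_X_add_C_of_natDegree_le_one hP
  have he : aeval z (C a * X + C b) = a * z + b := by simp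
  rw [he]
  have him' : 0 < |z.im| := abs_pos.mpr him
  have h1 : |(a : ℝ)| ≤ ‖a * z + b‖ / |z.im| := by
    rw [le_div_iff₀ him', ← abs_mul]
    have := Complex.abs_im_le_norm (a * z + b)
    simpa using this
  have h2 : |(b : ℝ)| ≤ ‖a * z + b‖ + ‖a * z + b‖ / |z.im| := by
    have h3 : ‖(b : ℂ)‖ ≤ ‖a * z + b‖ + ‖(a : ℂ) * z‖ := by
      have := norm_sub_le (a * z + b) (a * z)
      simpa using this
    have h4 : ‖(a : ℂ) * z‖ = |(a : ℝ)| := by simp [hz]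
    have h5 : ‖(b : ℂ)‖ = |(b : ℝ)| := by simp
    linarith
  have h6 : L ((a * z + b) * x) ≤ |(a : ℝ)| * L x + d + |(b : ℝ)| * L x := by
    have e : (a * z + b) * x = z * (a * x) + b * x := by ring
    rw [e]
    linarith [hadd (z * (a * x)) (b * x), hrot (a * x),
      subadditive_intCast_mul_le hadd h0 hneg a x, subadditive_intCast_mul_le hadd h0 hneg b x]
  have h7 : (|(a : ℝ)| + |(b : ℝ)|) * L x ≤ ((1 + 2 / |z.im|) * ‖a * z + b‖) * L x := by
    apply mul_le_mul_of_nonneg_right _ (hL x)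
    have : (1 + 2 / |z.im|) * ‖a * z + b‖ =
      ‖a * z + b‖ / |z.im| + (‖a * z + b‖ + ‖a * z + b‖ / |z.im|) := by ring
    linarith
  linarith

open Polynomial in
/-- Rewriting `P(z)` with digits bounded by `B`, lowest digit first, by means of the relation
`B z² = A z - B`. -/
lemma subadditive_aeval_le (hadd : ∀ x y, L (x + y) ≤ L x + L y)
    (h0 : L 0 = 0) (hneg : ∀ x, L (-x) = L x) (hrot : ∀ x, L (z * x) ≤ L x + d)
    (hL : ∀ x, 0 ≤ L x) (hz : ‖z‖ = 1) (him : z.im ≠ 0)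
    {A B : ℤ} (hB : 0 < B) (hrel : B * z ^ 2 = A * z - B) (x : ℂ) (k : ℕ) :
    ∀ P : ℤ[X], P.natDegree ≤ k + 1 → L (aeval z P * x) ≤
      (1 + 2 / |z.im|) * √(‖aeval z P‖ ^ 2 + k * (B : ℝ) ^ 2) * L x + k * (B * L x + d) + d := by
  induction k with
  | zero =>
    intro P hP
    have := subadditive_aeval_le_of_natDegree_le_one hadd h0 hneg hrot hL hz him P
      (by simpa using hP) x
    simpa using this
  | succ k ih =>
    intro P hP
    obtain ⟨q, r, hqr, hr, hs⟩ := exists_signed_residue (P.coeff 0) hB (aeval z P).re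
    -- The carry `B q` moves to higher digits by `B = A z - B z²`; after division by `z` it
    -- contributes `q A - q B z`.
    set Q : ℤ[X] := P.divX + C (q * A) - C (q * B) * X with hQ
    have hdeg : Q.natDegree ≤ k + 1 := by
      refine (natDegree_sub_le _ _).trans (max_le ((natDegree_add_le _ _).trans (max_le ?_ ?_)) ?_)
      · rw [natDegree_divX_eq_natDegree_tsub_one]; omega
      · rw [natDegree_C]; omega
      · exact (natDegree_C_mul_le _ _).trans (by simp)
    have hval : aeval z P = r + z * aeval z Q := by
      have h1 : aeval z P = aeval z P.divX * z + P.coeff 0 := by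
        conv_lhs => rw [← divX_mul_X_add P]
        simp
      rw [h1, hqr, hQ]
      simp only [map_sub, map_add, map_mul, aeval_X]
      simp only [eq_intCast, map_intCast]
      push_cast
      linear_combination (q : ℂ) * hrel
    have hnorm : ‖aeval z Q‖ ^ 2 ≤ ‖aeval z P‖ ^ 2 + (B : ℝ) ^ 2 := by
      have h2 : ‖aeval z Q‖ = ‖aeval z P - r‖ := by
        rw [hval]; simp [hz]
      rw [h2]
      exact norm_sub_intCast_sq_le hr hs
    have hstep : L (aeval z P * x) ≤ B * L x + d + L (aeval z Q * x) := by
      have e : aeval z P * x = r * x + z * (aeval z Q * x) := by rw [hval]; ring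
      rw [e]
      have h3 : |(r : ℝ)| * L x ≤ B * L x :=
        mul_le_mul_of_nonneg_right (by exact_mod_cast hr) (hL x)
      linarith [hadd (r * x) (z * (aeval z Q * x)), hrot (aeval z Q * x),
        subadditive_intCast_mul_le hadd h0 hneg r x]
    have h4 := ih Q hdeg
    have h5 : (1 + 2 / |z.im|) * √(‖aeval z Q‖ ^ 2 + k * (B : ℝ) ^ 2) * L x ≤
        (1 + 2 / |z.im|) * √(‖aeval z P‖ ^ 2 + (k + 1 : ℕ) * (B : ℝ) ^ 2) * L x := by
      have := hL x
      gcongr ?_ * √(?_) * ?_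
      push_cast
      linarith
    push_cast at h5 ⊢
    linarith

open Polynomial in
/-- Words of length linear in `k` suffice to reach a translation of size `B⁻ᵏ`. -/
theorem subadditive_contraction_le (hadd : ∀ x y, L (x + y) ≤ L x + L y)
    (h0 : L 0 = 0) (hneg : ∀ x, L (-x) = L x) (hrot : ∀ x, L (z * x) ≤ L x + d)
    (hL : ∀ x, 0 ≤ L x) (hz : ‖z‖ = 1) (him : z.im ≠ 0) (hd : 0 ≤ d)
    {A B : ℤ} (hB : 0 < B) (hAB : IsCoprime A B) (hrel : B * z ^ 2 = A * z - B) (x : ℂ) (k : ℕ) :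
    L (z ^ k / B ^ k * x) ≤ 10 * B * (1 + 2 / |z.im|) * (k + 1) * (L x + d) := by
  obtain ⟨u, w, huw⟩ := hAB
  have hB0 : (B : ℂ) ≠ 0 := by exact_mod_cast hB.ne'
  have hB1 : (1 : ℝ) ≤ B := by exact_mod_cast hB
  -- Since `z² + 1 = (A / B) z`, Bézout gives `u (z² + 1) + w z = z / B`. The degree is at most `2
  -- k`, hence `2 * k` digits.
  set P : ℤ[X] := (C u * (X ^ 2 + 1) + C w * X) ^ k with hP
  have hdeg : P.natDegree ≤ 2 * k + 1 := by
    have h1 : (C u * (X ^ 2 + 1) + C w * X : ℤ[X]).natDegree ≤ 2 := by compute_degree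
    have := natDegree_pow_le_of_le k h1
    linarith
  have hval : aeval z P = z ^ k / B ^ k := by
    rw [hP, map_pow, ← div_pow]
    congr 1
    rw [eq_div_iff hB0]
    have huw' : (u : ℂ) * A + w * B = 1 := by exact_mod_cast huw
    simp only [map_add, map_mul, map_pow, aeval_X, map_one, eq_intCast, map_intCast]
    linear_combination (u : ℂ) * hrel + z * huw'
  have hn : ‖aeval z P‖ ≤ 1 := by
    rw [hval]
    simp only [norm_div, norm_pow, hz, one_pow]
    rw [div_le_one (by simp; positivity)]
    apply one_le_pow₀
    simpa [abs_of_pos (show (0 : ℝ) < B by linarith)] using hB1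
  have key := subadditive_aeval_le hadd h0 hneg hrot hL hz him hB hrel x (2 * k) P hdeg
  rw [hval] at key hn
  have hs : √(‖z ^ k / (B : ℂ) ^ k‖ ^ 2 + (2 * k : ℕ) * (B : ℝ) ^ 2) ≤ B * (1 + 2 * k) := by
    apply Real.sqrt_le_iff.mpr
    refine ⟨by positivity, ?_⟩
    have : ‖z ^ k / (B : ℂ) ^ k‖ ^ 2 ≤ 1 := pow_le_one₀ (norm_nonneg _) hn
    have h2 : (1 : ℝ) ≤ B ^ 2 := one_le_pow₀ hB1
    push_cast
    have hk : (0 : ℝ) ≤ k := k.cast_nonneg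
    nlinarith [mul_nonneg (sq_nonneg (B : ℝ)) hk, mul_nonneg (sq_nonneg (B : ℝ)) (mul_nonneg hk hk)]
  set M := 1 + 2 / |z.im| with hM
  have hM1 : 1 ≤ M := by
    rw [hM]; have : 0 ≤ 2 / |z.im| := by positivity
    linarith
  have hx := hL x
  have hk : (0 : ℝ) ≤ k := k.cast_nonneg
  have h1 : M * √(‖z ^ k / (B : ℂ) ^ k‖ ^ 2 + (2 * k : ℕ) * (B : ℝ) ^ 2) * L x ≤
      M * (B * (1 + 2 * k)) * L x := by gcongr
  have h2 : (2 * k : ℝ) * (B * L x + d) + d ≤ M * (B * ((2 * k + 1) * (L x + d))) := by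
    have a1 : (2 * k : ℝ) * (B * L x + d) + d ≤ B * ((2 * k + 1) * (L x + d)) := by
      have : d * (2 * k + 1) ≤ B * (d * (2 * k + 1)) := le_mul_of_one_le_left (by positivity) hB1
      nlinarith [mul_nonneg (show (0 : ℝ) ≤ B by linarith) hx]
    exact a1.trans (le_mul_of_one_le_left (by positivity) hM1)
  push_cast at key h1
  have hMB : 0 ≤ M * B := by positivity
  calc L (z ^ k / B ^ k * x) ≤ M * (B * (1 + 2 * k)) * L x + M * (B * ((2 * k + 1) * (L x + d))) := by
        linarith
    _ = M * B * ((2 * k + 1) * (2 * L x + d)) := by ring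
    _ ≤ M * B * (10 * (k + 1) * (L x + d)) := by
        apply mul_le_mul_of_nonneg_left _ hMB
        nlinarith [mul_nonneg hk hx, mul_nonneg hk hd]
    _ = _ := by ring

end Digits

/-! ### Algebra of rigid motions, noncommuting quotients and the quadratic relation -/

section RigidMotions

/-- The rotation part `e^{iθ(g)}`. -/
def rot (g : rigidMotions) : ℂ := Complex.exp (angle g * Complex.I)

lemma coe_apply_eq (g : rigidMotions) (x : ℂ) : (g : ℂ ≃ᵢ ℂ) x = rot g * x + trans g :=
  apply_eq g x

@[simp] lemma norm_rot (g : rigidMotions) : ‖rot g‖ = 1 := Complex.norm_exp_ofReal_mul_I _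

lemma rot_ne_zero (g : rigidMotions) : rot g ≠ 0 := Complex.exp_ne_zero _

lemma rot_eq_of_forall {g : rigidMotions} {a b : ℂ} (h : ∀ x, (g : ℂ ≃ᵢ ℂ) x = a * x + b) :
    rot g = a := by
  have h0 := h 0
  have h1 := h 1
  rw [coe_apply_eq] at h0 h1
  linear_combination h1 - h0

lemma trans_eq_of_forall {g : rigidMotions} {a b : ℂ} (h : ∀ x, (g : ℂ ≃ᵢ ℂ) x = a * x + b) :
    trans g = b := by
  have h0 := h 0
  rw [coe_apply_eq] at h0
  linear_combination h0

lemma ext_rot_trans {g h : rigidMotions} (hr : rot g = rot h) (ht : trans g = trans h) : g = h := by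
  apply Subtype.ext
  ext x
  rw [coe_apply_eq, coe_apply_eq, hr, ht]

lemma mul_coe_apply (g h : rigidMotions) (x : ℂ) : ((g * h : rigidMotions) : ℂ ≃ᵢ ℂ) x =
    rot g * rot h * x + (rot g * trans h + trans g) := by
  rw [Subgroup.coe_mul, IsometryEquiv.mul_apply, coe_apply_eq, coe_apply_eq]
  ring

lemma rot_mul (g h : rigidMotions) : rot (g * h) = rot g * rot h :=
  rot_eq_of_forall (mul_coe_apply g h)

lemma trans_mul (g h : rigidMotions) : trans (g * h) = rot g * trans h + trans g :=
  trans_eq_of_forall (mul_coe_apply g h)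

lemma one_coe_apply (x : ℂ) : ((1 : rigidMotions) : ℂ ≃ᵢ ℂ) x = 1 * x + 0 := by simp

@[simp] lemma rot_one : rot 1 = 1 := rot_eq_of_forall one_coe_apply

@[simp] lemma trans_one : trans 1 = 0 := trans_eq_of_forall one_coe_apply

lemma rot_inv (g : rigidMotions) : rot g⁻¹ = (rot g)⁻¹ := by
  have := rot_mul g⁻¹ g
  rw [inv_mul_cancel, rot_one] at this
  exact eq_inv_of_mul_eq_one_left this.symm

lemma trans_inv (g : rigidMotions) : trans g⁻¹ = -((rot g)⁻¹ * trans g) := by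
  have := trans_mul g⁻¹ g
  rw [inv_mul_cancel, trans_one, rot_inv] at this
  linear_combination -this

/-- The translation by `x`. -/
def translation (x : ℂ) : rigidMotions :=
  ⟨IsometryEquiv.addRight x, 0, fun y => by simp⟩

lemma translation_coe_apply (x y : ℂ) : (translation x : ℂ ≃ᵢ ℂ) y = 1 * y + x := by
  simp [translation]

@[simp] lemma rot_translation (x : ℂ) : rot (translation x) = 1 :=
  rot_eq_of_forall (translation_coe_apply x)

@[simp] lemma trans_translation (x : ℂ) : trans (translation x) = x :=
  trans_eq_of_forall (translation_coe_apply x)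

lemma translation_zero : translation 0 = 1 := ext_rot_trans (by simp) (by simp)

lemma translation_add (x y : ℂ) : translation (x + y) = translation x * translation y :=
  ext_rot_trans (by simp [rot_mul]) (by simp [trans_mul, add_comm])

lemma translation_neg (x : ℂ) : translation (-x) = (translation x)⁻¹ :=
  ext_rot_trans (by simp [rot_inv]) (by simp [trans_inv])

lemma translation_rot_mul (h : rigidMotions) (x : ℂ) :
    translation (rot h * x) = h * translation x * h⁻¹ := by
  rw [eq_mul_inv_iff_mul_eq]
  exact ext_rot_trans (by simp [rot_mul]) (by simp [trans_mul, add_comm])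

lemma translation_commutator (g h : rigidMotions) :
    translation ((rot g - 1) * trans h - (rot h - 1) * trans g) = g * h * g⁻¹ * h⁻¹ := by
  rw [eq_mul_inv_iff_mul_eq, eq_mul_inv_iff_mul_eq]
  refine ext_rot_trans (by simp [rot_mul, mul_comm]) ?_
  simp only [trans_mul, rot_mul, rot_translation, trans_translation]
  ring

lemma eq_one_of_re_rot_eq_one {g : rigidMotions} (h : (rot g).re = 1) : rot g = 1 := by
  have h1 : (rot g).re ^ 2 + (rot g).im ^ 2 = 1 := by
    have := Complex.normSq_eq_norm_sq (rot g)
    rw [norm_rot, Complex.normSq_apply] at this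
    linarith
  have h2 : (rot g).im = 0 := by
    rw [h] at h1
    exact pow_eq_zero_iff (two_ne_zero) |>.mp (by linarith)
  exact Complex.ext h h2

lemma re_rot_le_one (g : rigidMotions) : (rot g).re ≤ 1 :=
  (Complex.re_le_norm _).trans (norm_rot g).le

/-- A centred walk whose steps do not all fix the origin has two pairs of steps whose quotients do
not commute. -/
lemma exists_commutator_ne_zero {S : Finset rigidMotions} {w : rigidMotions → ℝ}
    (hw : ∀ g ∈ S, 0 < w g) (hinv : ∀ g ∈ S, g⁻¹ ∈ S)
    (hdrift : ∑ g ∈ S, (w g : ℂ) * trans g = 0) {g₀ : rigidMotions} (hg₀ : g₀ ∈ S)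
    (hrot : rot g₀ ^ 2 ≠ 1) (hne : ∃ g ∈ S, trans g ≠ 0) :
    ∃ a ∈ S, ∃ b ∈ S, (rot (g₀ * g₀) - 1) * trans (a⁻¹ * b) -
      (rot (a⁻¹ * b) - 1) * trans (g₀ * g₀) ≠ 0 := by
  by_contra! hcon
  set h := g₀ * g₀ with hh
  have hz : rot h - 1 ≠ 0 := by
    rw [hh, rot_mul, ← sq]; exact sub_ne_zero.mpr hrot
  -- `p` is the fixed point of `h`. A quotient `a⁻¹ b` whose commutator with `h` is trivial fixes
  -- `p` too, so all steps send `p` to the same point, called `q` below.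
  set p : ℂ := -trans h / (rot h - 1) with hp
  have hp' : (rot h - 1) * p = -trans h := by rw [hp]; field_simp
  have hfix : ∀ a ∈ S, ∀ b ∈ S, rot b * p + trans b = rot a * p + trans a := by
    intro a ha b hb
    have h1 := hcon a ha b hb
    have h2 : (rot h - 1) * (rot (a⁻¹ * b) * p + trans (a⁻¹ * b) - p) = 0 := by
      linear_combination h1 + (rot (a⁻¹ * b) - 1) * hp'
    have h3 := (mul_eq_zero.mp h2).resolve_left hz
    rw [rot_mul, trans_mul, rot_inv, trans_inv] at h3
    have hr := rot_ne_zero a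
    field_simp at h3
    linear_combination h3
  set q : ℂ := rot g₀ * p + trans g₀ with hq
  have hback : rot g₀ * q + trans g₀ = p := by
    have h1 := hfix g₀ hg₀ g₀⁻¹ (hinv _ hg₀)
    rw [rot_inv, trans_inv] at h1
    have hr := rot_ne_zero g₀
    field_simp at h1
    linear_combination -h1
  -- `g₀` exchanges `p` and `q`, which forces `p = q` because its rotation part is not `-1`.
  have hpq : p = q := by
    have h1 : (rot g₀ + 1) * (p - q) = 0 := by linear_combination hq - hback
    rcases mul_eq_zero.mp h1 with h2 | h2
    · exact absurd (by rw [eq_neg_of_add_eq_zero_left h2]; ring) hrot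
    · exact sub_eq_zero.mp h2
  have hall : ∀ a ∈ S, trans a = (1 - rot a) * p := by
    intro a ha
    have := hfix g₀ hg₀ a ha
    linear_combination this - hpq
  have hp0 : p ≠ 0 := by
    rintro h0
    obtain ⟨g, hg, hg'⟩ := hne
    exact hg' (by rw [hall g hg, h0, mul_zero])
  -- `p` is now a common fixed point. If it is not `0`, zero drift makes the mean of `1 - rot g`
  -- vanish, and nonnegativity of the real parts forces `rot g₀ = 1`.
  have hsum : (∑ g ∈ S, (w g : ℂ) * (1 - rot g)) * p = 0 := by
    rw [← hdrift, Finset.sum_mul]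
    exact Finset.sum_congr rfl fun g hg => by rw [hall g hg]; ring
  have hsum' := congrArg Complex.re ((mul_eq_zero.mp hsum).resolve_right hp0)
  simp only [Complex.re_sum, Complex.zero_re, Complex.re_ofReal_mul, Complex.sub_re,
    Complex.one_re] at hsum'
  have hz0 := (Finset.sum_eq_zero_iff_of_nonneg fun g hg =>
    mul_nonneg (hw g hg).le (by linarith [re_rot_le_one g])).mp hsum' g₀ hg₀
  have h1 : (rot g₀).re = 1 := by
    have := (mul_eq_zero.mp hz0).resolve_left (hw g₀ hg₀).ne'
    linarith
  exact hrot (by rw [eq_one_of_re_rot_eq_one h1]; ring)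

/-- If `cos θ` is rational but not a half-integer, then `z = e^{2iθ}` is not real and is a root of
a primitive quadratic `B X² - A X + B` with `B ≥ 2`. -/
lemma exists_quadratic_relation {g : rigidMotions} {q : ℚ} (hq : Real.cos (angle g) = q)
    (hhalf : ∀ k : ℤ, Real.cos (angle g) ≠ k / 2) :
    ∃ A B : ℤ, 2 ≤ B ∧ IsCoprime A B ∧ (B : ℂ) * rot (g * g) ^ 2 = A * rot (g * g) - B ∧
      (rot (g * g)).im ≠ 0 := by
  set m : ℚ := 4 * q ^ 2 - 2 with hm
  have hz : rot (g * g) = Complex.exp ((2 * angle g : ℝ) * Complex.I) := by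
    rw [rot_mul, rot, ← Complex.exp_add]; congr 1; push_cast; ring
  have hcos : 2 * Real.cos (2 * angle g) = m := by
    rw [Real.cos_two_mul, hq, hm]; push_cast; ring
  -- `m = 2 cos 2θ` is the coefficient in `z² + 1 = m z`, written in lowest terms. If `m` were an
  -- integer, so would be `(2q)²`, hence `2q`, and `cos θ` would be a half-integer.
  refine ⟨m.num, m.den, ?_, ?_, ?_, ?_⟩
  · by_contra hlt
    have hden : m.den = 1 := by
      have := m.den_pos
      omega
    have h1 : ((2 * q) ^ 2).den = 1 := by
      have h2 : (2 * q) ^ 2 = ((m.num + 2 : ℤ) : ℚ) := by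
        have : (m.num : ℚ) = m := Rat.den_eq_one_iff m |>.mp hden
        push_cast
        rw [this, hm]; ring
      rw [h2]; exact Rat.den_intCast _
    rw [Rat.den_pow] at h1
    have h3 : (2 * q).den = 1 := by simpa using h1
    have h4 : ((2 * q).num : ℚ) = 2 * q := Rat.den_eq_one_iff _ |>.mp h3
    apply hhalf (2 * q).num
    rw [hq, eq_div_iff two_ne_zero, mul_comm]
    exact_mod_cast h4.symm
  · rw [Int.isCoprime_iff_gcd_eq_one]
    exact m.reduced
  · have hz2 : rot (g * g) ^ 2 + 1 = m * rot (g * g) := by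
      have hm' : (m : ℂ) = 2 * Complex.cos ((2 * angle g : ℝ) : ℂ) := by
        have := congrArg (fun t : ℝ => (t : ℂ)) hcos
        simp only [Complex.ofReal_mul, Complex.ofReal_cos] at this ⊢
        push_cast at this ⊢
        exact this.symm
      rw [hm', hz, Complex.two_cos, sq, add_mul, ← Complex.exp_add]
      rw [← Complex.exp_add]
      simp
    have hmd : (m : ℂ) * (m.den : ℂ) = m.num := by exact_mod_cast Rat.mul_den_eq_num m
    push_cast
    linear_combination (m.den : ℂ) * hz2 + rot (g * g) * hmd
  · rw [hz, Complex.exp_ofReal_mul_I_im, Real.sin_two_mul]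
    have hc : Real.cos (angle g) ≠ 0 := by simpa using hhalf 0
    have hs : Real.sin (angle g) ≠ 0 := by
      intro hs
      have h1 := Real.sin_sq_add_cos_sq (angle g)
      rw [hs] at h1
      have h2 : Real.cos (angle g) * Real.cos (angle g) = 1 := by linarith
      rcases mul_self_eq_one_iff.mp h2 with h3 | h3
      · exact hhalf 2 (by rw [h3]; norm_num)
      · exact hhalf (-2) (by rw [h3]; norm_num)
    exact mul_ne_zero (mul_ne_zero two_ne_zero hs) hc

end RigidMotions

/-! ### Unitary representations on functions on the circle -/

section CircleOperators

open ContinuousMap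

local notation "𝕋" => AddCircle (2 * Real.pi)

instance fact_two_pi_pos : Fact (0 < 2 * Real.pi) := ⟨Real.two_pi_pos⟩

/-- The point `e^{iα}` of the unit circle. -/
def phase (α : 𝕋) : ℂ := (AddCircle.toCircle α : Circle)

@[simp] lemma norm_phase (α : 𝕋) : ‖phase α‖ = 1 := Circle.norm_coe _

lemma phase_coe (t : ℝ) : phase (t : 𝕋) = Complex.exp (t * Complex.I) := by
  rw [phase, AddCircle.toCircle_apply_mk, Circle.coe_exp, div_self Real.two_pi_pos.ne', one_mul]

lemma phase_add (α β : 𝕋) : phase (α + β) = phase α * phase β := by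
  simp [phase, AddCircle.toCircle_add]

lemma phase_neg (α : 𝕋) : phase (-α) = (phase α)⁻¹ := by
  simp [phase, AddCircle.toCircle_neg]

@[fun_prop] lemma continuous_phase : Continuous phase :=
  continuous_subtype_val.comp AddCircle.continuous_toCircle

lemma phase_injective : Function.Injective phase := fun _ _ h =>
  AddCircle.injective_toCircle Real.two_pi_pos.ne' (Circle.ext h)

/-- The rotation angle as an element of the circle `ℝ / 2πℤ`. -/
def ang (g : rigidMotions) : 𝕋 := (angle g : ℝ)

@[simp] lemma phase_ang (g : rigidMotions) : phase (ang g) = rot g := phase_coe _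

lemma ang_mul (g h : rigidMotions) : ang (g * h) = ang g + ang h :=
  phase_injective (by rw [phase_add, phase_ang, phase_ang, phase_ang, rot_mul])

lemma ang_eq_zero {g : rigidMotions} (h : rot g = 1) : ang g = 0 :=
  phase_injective (by rw [phase_ang, h]; simp [phase])

/-- The component of the vector `v` in direction `e^{iα}`. -/
def comp (v : ℂ) (α : 𝕋) : ℝ := (phase α * (starRingEnd ℂ) v).re

@[fun_prop] lemma continuous_comp (v : ℂ) : Continuous (comp v) := by unfold comp; fun_prop

lemma abs_comp_le (v : ℂ) (α : 𝕋) : |comp v α| ≤ ‖v‖ := by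
  refine (Complex.abs_re_le_norm _).trans ?_
  simp

lemma comp_add (v w : ℂ) (α : 𝕋) : comp (v + w) α = comp v α + comp w α := by
  simp only [comp, map_add, mul_add, Complex.add_re]

lemma conj_rot (g : rigidMotions) : (starRingEnd ℂ) (rot g) = (rot g)⁻¹ :=
  (Complex.inv_eq_conj (norm_rot g)).symm

lemma comp_sub_ang (v : ℂ) (g : rigidMotions) (α : 𝕋) :
    comp v (α - ang g) = comp (rot g * v) α := by
  rw [comp, comp, sub_eq_add_neg, phase_add, phase_neg, phase_ang, map_mul, conj_rot, mul_assoc]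

/-- The irreducible unitary representation of the group of rigid motions attached to the radius
`s`, acting on functions on the circle. -/
def act (s : ℝ) (g : rigidMotions) : C(𝕋, ℂ) →ₗ[ℂ] C(𝕋, ℂ) where
  toFun f := ⟨fun α => Complex.exp ((s * comp (trans g) α : ℝ) * Complex.I) * f (α - ang g), by
    fun_prop⟩
  map_add' f₁ f₂ := by ext α; simp [mul_add]
  map_smul' c f := by ext α; simp [mul_left_comm]

lemma act_apply (s : ℝ) (g : rigidMotions) (f : C(𝕋, ℂ)) (α : 𝕋) : act s g f α =
    Complex.exp ((s * comp (trans g) α : ℝ) * Complex.I) * f (α - ang g) := rfl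

lemma act_mul (s : ℝ) (g h : rigidMotions) (f : C(𝕋, ℂ)) :
    act s (g * h) f = act s g (act s h f) := by
  ext α
  rw [act_apply, act_apply, act_apply, comp_sub_ang, trans_mul, comp_add, ang_mul, ← mul_assoc,
    ← Complex.exp_add, sub_sub]
  congr 2
  push_cast
  ring

lemma act_one (s : ℝ) (f : C(𝕋, ℂ)) : act s 1 f = f := by
  ext α
  rw [act_apply, ang_eq_zero rot_one, trans_one]
  simp [comp]

lemma act_translation_apply (s : ℝ) (x : ℂ) (f : C(𝕋, ℂ)) (α : 𝕋) :
    act s (translation x) f α = Complex.exp ((s * comp x α : ℝ) * Complex.I) * f α := by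
  rw [act_apply, ang_eq_zero (rot_translation x), trans_translation, sub_zero]

/-- The `L²` norm on the circle. -/
def l2 (f : C(𝕋, ℂ)) : ℝ := ‖ContinuousMap.toLp (E := ℂ) 2 (volume : Measure 𝕋) ℂ f‖

lemma l2_nonneg (f : C(𝕋, ℂ)) : 0 ≤ l2 f := norm_nonneg _

lemma l2_add_le (f g : C(𝕋, ℂ)) : l2 (f + g) ≤ l2 f + l2 g := by
  unfold l2; rw [map_add]; exact norm_add_le _ _

lemma l2_sub_le (f g : C(𝕋, ℂ)) : l2 (f - g) ≤ l2 f + l2 g := by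
  unfold l2; rw [map_sub]; exact norm_sub_le _ _

lemma l2_neg (f : C(𝕋, ℂ)) : l2 (-f) = l2 f := by
  unfold l2; rw [map_neg]; exact norm_neg _

lemma l2_smul (c : ℂ) (f : C(𝕋, ℂ)) : l2 (c • f) = ‖c‖ * l2 f := by
  unfold l2; rw [map_smul]; exact norm_smul _ _

lemma l2_zero : l2 0 = 0 := by
  unfold l2; rw [map_zero]; exact norm_zero

lemma l2_sq (f : C(𝕋, ℂ)) : l2 f ^ 2 = ∫ α, ‖f α‖ ^ 2 := by
  unfold l2
  have h := ContinuousMap.inner_toLp (𝕜 := ℂ) (volume : Measure 𝕋) f f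
  rw [inner_self_eq_norm_sq_to_K] at h
  have h2 : ((‖ContinuousMap.toLp (E := ℂ) 2 (volume : Measure 𝕋) ℂ f‖ ^ 2 : ℝ) : ℂ) =
      ((∫ α, ‖f α‖ ^ 2 : ℝ) : ℂ) := by
    rw [← integral_complex_ofReal]
    push_cast
    refine h.trans (integral_congr_ae (ae_of_all _ fun α => ?_))
    simp [Complex.mul_conj']
  exact_mod_cast h2

lemma integrable_circle {E : Type*} [NormedAddCommGroup E] {f : 𝕋 → E} (hf : Continuous f) :
    Integrable f :=
  hf.integrable_of_hasCompactSupport (HasCompactSupport.of_compactSpace f)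

lemma l2_act (s : ℝ) (g : rigidMotions) (f : C(𝕋, ℂ)) : l2 (act s g f) = l2 f := by
  rw [← sq_eq_sq₀ (l2_nonneg _) (l2_nonneg _), l2_sq, l2_sq]
  simp only [act_apply, norm_mul, Complex.norm_exp_ofReal_mul_I, one_mul]
  exact integral_sub_right_eq_self (fun α => ‖f α‖ ^ 2) (ang g)

lemma l2_le_of_norm_le {f : C(𝕋, ℂ)} {c : ℝ} (hc : 0 ≤ c) (hf : ∀ α, ‖f α‖ ≤ c) :
    l2 f ≤ 3 * c := by
  have h : l2 f ^ 2 ≤ 2 * Real.pi * c ^ 2 := by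
    rw [l2_sq]
    calc ∫ α, ‖f α‖ ^ 2 ≤ ∫ _ : 𝕋, c ^ 2 := by
          apply integral_mono (integrable_circle (by fun_prop)) (integrable_const _)
          intro α
          exact pow_le_pow_left₀ (norm_nonneg _) (hf α) 2
      _ = 2 * Real.pi * c ^ 2 := by
          simp [Measure.real, AddCircle.measure_univ, Real.pi_pos.le]
  -- The circle has total mass `2π`, and `3` bounds `√(2π)`.
  have h2 : l2 f ^ 2 ≤ (3 * c) ^ 2 := by nlinarith [Real.pi_lt_d2, sq_nonneg c]
  exact le_of_sq_le_sq h2 (by positivity)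

end CircleOperators

/-! ### Averaging operators and almost fixed functions -/

section SpectralGap

local notation "𝕋" => AddCircle (2 * Real.pi)

/-- A variance identity: the squared norm lost in averaging is half the mean squared distance of two
independent draws. -/
lemma norm_sum_smul_sq {ι H : Type*} [NormedAddCommGroup H] [InnerProductSpace ℂ H]
    (S : Finset ι) (w : ι → ℝ) (hw : ∑ i ∈ S, w i = 1) (x : ι → H) :
    ‖∑ i ∈ S, (w i : ℂ) • x i‖ ^ 2 =
      ∑ i ∈ S, w i * ‖x i‖ ^ 2 - 1 / 2 * ∑ i ∈ S, ∑ j ∈ S, w i * w j * ‖x i - x j‖ ^ 2 := by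
  have h1 : ‖∑ i ∈ S, (w i : ℂ) • x i‖ ^ 2 =
      ∑ i ∈ S, ∑ j ∈ S, w i * w j * (inner ℂ (x i) (x j)).re := by
    have := inner_self_eq_norm_sq (𝕜 := ℂ) (∑ i ∈ S, (w i : ℂ) • x i)
    rw [← this, sum_inner]
    simp_rw [inner_sum, inner_smul_left, inner_smul_right]
    simp [mul_assoc]
  have h2 : ∀ i j, ‖x i - x j‖ ^ 2 = ‖x i‖ ^ 2 - 2 * (inner ℂ (x i) (x j)).re + ‖x j‖ ^ 2 :=
    fun i j => norm_sub_sq (𝕜 := ℂ) (x i) (x j)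
  have h3 : ∑ i ∈ S, ∑ j ∈ S, w i * w j * ‖x i‖ ^ 2 = ∑ i ∈ S, w i * ‖x i‖ ^ 2 := by
    refine Finset.sum_congr rfl fun i _ => ?_
    calc ∑ j ∈ S, w i * w j * ‖x i‖ ^ 2 = (∑ j ∈ S, w j) * (w i * ‖x i‖ ^ 2) := by
          rw [Finset.sum_mul]; exact Finset.sum_congr rfl fun j _ => by ring
      _ = _ := by rw [hw, one_mul]
  have h4 : ∑ i ∈ S, ∑ j ∈ S, w i * w j * ‖x j‖ ^ 2 = ∑ i ∈ S, w i * ‖x i‖ ^ 2 := by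
    rw [Finset.sum_comm, ← h3]
    exact Finset.sum_congr rfl fun i _ => Finset.sum_congr rfl fun j _ => by ring
  have h5 : ∑ i ∈ S, ∑ j ∈ S, w i * w j * ‖x i - x j‖ ^ 2 =
      ∑ i ∈ S, ∑ j ∈ S, w i * w j * ‖x i‖ ^ 2 -
        2 * ∑ i ∈ S, ∑ j ∈ S, w i * w j * (inner ℂ (x i) (x j)).re +
        ∑ i ∈ S, ∑ j ∈ S, w i * w j * ‖x j‖ ^ 2 := by
    rw [Finset.mul_sum, ← Finset.sum_sub_distrib, ← Finset.sum_add_distrib]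
    refine Finset.sum_congr rfl fun i _ => ?_
    rw [Finset.mul_sum, ← Finset.sum_sub_distrib, ← Finset.sum_add_distrib]
    refine Finset.sum_congr rfl fun j _ => ?_
    rw [h2]; ring
  rw [h1, h5, h3, h4]
  ring

/-- The averaging operator of the walk in the representation of radius `s`. -/
def avg (s : ℝ) (S : Finset rigidMotions) (w : rigidMotions → ℝ) : C(𝕋, ℂ) →ₗ[ℂ] C(𝕋, ℂ) :=
  ∑ g ∈ S, (w g : ℂ) • act s g

lemma avg_eq (s : ℝ) (S : Finset rigidMotions) (w : rigidMotions → ℝ) (f : C(𝕋, ℂ)) :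
    avg s S w f = ∑ g ∈ S, (w g : ℂ) • act s g f := by
  simp [avg, LinearMap.sum_apply]

lemma avg_apply (s : ℝ) (S : Finset rigidMotions) (w : rigidMotions → ℝ) (f : C(𝕋, ℂ)) (α : 𝕋) :
    avg s S w f α = ∑ g ∈ S, (w g : ℂ) * act s g f α := by
  simp [avg_eq, ContinuousMap.sum_apply]

/-- One term of the variance identity is kept, unitarity giving `l2 f ^ 2` for the mean of the
squared norms. A function that averaging hardly shrinks is moved almost alike by any two steps. -/
lemma l2_act_sub_act_le {s : ℝ} {S : Finset rigidMotions} {w : rigidMotions → ℝ}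
    (hw : ∀ g ∈ S, 0 < w g) (hw1 : ∑ g ∈ S, w g = 1) (f : C(𝕋, ℂ)) {a b : rigidMotions}
    (ha : a ∈ S) (hb : b ∈ S) :
    w a * w b * l2 (act s a f - act s b f) ^ 2 ≤ 2 * (l2 f ^ 2 - l2 (avg s S w f) ^ 2) := by
  have h1 := norm_sum_smul_sq S w hw1
    (fun g => ContinuousMap.toLp (E := ℂ) 2 (volume : Measure 𝕋) ℂ (act s g f))
  simp_rw [← map_sub, ← map_smul, ← map_sum] at h1
  simp only [LinearMap.map_smul] at h1
  rw [← avg_eq] at h1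
  change l2 _ ^ 2 = ∑ g ∈ S, w g * l2 _ ^ 2 - 1 / 2 * ∑ g ∈ S, ∑ h ∈ S, w g * w h * l2 _ ^ 2 at h1
  simp_rw [l2_act] at h1
  rw [← Finset.sum_mul, hw1, one_mul] at h1
  have h2 : w a * w b * l2 (act s a f - act s b f) ^ 2 ≤
      ∑ g ∈ S, ∑ h ∈ S, w g * w h * l2 (act s g f - act s h f) ^ 2 := by
    have hnn : ∀ g ∈ S, ∀ h ∈ S, 0 ≤ w g * w h * l2 (act s g f - act s h f) ^ 2 := fun g hg h hh =>
      mul_nonneg (mul_nonneg (hw g hg).le (hw h hh).le) (sq_nonneg _)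
    exact (Finset.single_le_sum (f := fun h => w a * w h * l2 (act s a f - act s h f) ^ 2)
      (hnn a ha) hb).trans (Finset.single_le_sum
        (f := fun g => ∑ h ∈ S, w g * w h * l2 (act s g f - act s h f) ^ 2)
        (fun g hg => Finset.sum_nonneg (hnn g hg)) ha)
  linarith

/-- How far `f` is moved by `g`. -/
def disp (s : ℝ) (f : C(𝕋, ℂ)) (g : rigidMotions) : ℝ := l2 (act s g f - f)

variable {s : ℝ} {f : C(𝕋, ℂ)}

lemma disp_nonneg (g : rigidMotions) : 0 ≤ disp s f g := l2_nonneg _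

lemma disp_one : disp s f 1 = 0 := by
  rw [disp, act_one, sub_self, l2_zero]

lemma disp_mul_le (g h : rigidMotions) : disp s f (g * h) ≤ disp s f g + disp s f h := by
  have e : act s (g * h) f - f = act s g (act s h f - f) + (act s g f - f) := by
    rw [act_mul, map_sub]; abel
  calc disp s f (g * h) ≤ l2 (act s g (act s h f - f)) + l2 (act s g f - f) := by
        rw [disp, e]; exact l2_add_le _ _
    _ = _ := by rw [l2_act, add_comm]; rfl

lemma disp_inv_mul (g h : rigidMotions) :
    disp s f (g⁻¹ * h) = l2 (act s h f - act s g f) := by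
  rw [← l2_act s g⁻¹, map_sub, ← act_mul, ← act_mul, inv_mul_cancel, act_one, disp]

lemma disp_inv (g : rigidMotions) : disp s f g⁻¹ = disp s f g := by
  have := disp_inv_mul (s := s) (f := f) g 1
  rw [mul_one, act_one] at this
  rw [this, ← l2_neg, neg_sub, disp]

lemma half_abs_le_norm_exp_sub_one {t : ℝ} (ht : |t| ≤ 1) :
    |t| / 2 ≤ ‖Complex.exp (t * Complex.I) - 1‖ := by
  rw [mul_comm, Complex.norm_exp_I_mul_ofReal_sub_one, Real.norm_eq_abs, abs_mul, abs_two]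
  have hpi := Real.pi_gt_three
  have h1 : |t / 2| ≤ Real.pi / 2 := by rw [abs_div, abs_two]; linarith
  have h2 := Real.mul_abs_le_abs_sin h1
  have h3 : 1 / 4 * |t| ≤ 2 / Real.pi * |t / 2| := by
    rw [abs_div, abs_two]
    have : (1 : ℝ) / 2 ≤ 2 / Real.pi := by
      rw [div_le_div_iff₀ (by norm_num) Real.pi_pos]; linarith [Real.pi_lt_d2]
    nlinarith [abs_nonneg t]
  linarith

/-- With `p` the vector `x` seen in the frame of `α`, `Im z · Im p = Re z · Re p - Re (z p)`. So no
direction is nearly orthogonal to both `x` and `z x`. -/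
lemma sq_im_mul_sq_norm_le (z x : ℂ) (hz : ‖z‖ = 1) (α : 𝕋) :
    z.im ^ 2 * ‖x‖ ^ 2 ≤ 3 * (comp x α ^ 2 + comp (z * x) α ^ 2) := by
  set p : ℂ := (starRingEnd ℂ) (phase α * (starRingEnd ℂ) x) with hp
  have h1 : comp x α = p.re := by simp [hp, comp]
  have h2 : comp (z * x) α = (z * p).re := by
    rw [comp, ← Complex.conj_re]
    congr 1
    simp only [hp, map_mul, Complex.conj_conj]
    ring
  have h3 : ‖x‖ = ‖p‖ := by simp [hp]
  have hz' : z.re ^ 2 + z.im ^ 2 = 1 := by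
    have := Complex.normSq_eq_norm_sq z
    rw [hz, Complex.normSq_apply] at this
    linarith
  rw [h1, h2, h3, ← Complex.normSq_eq_norm_sq, Complex.normSq_apply, Complex.mul_re]
  nlinarith [sq_nonneg (z.re * p.re + (z.re * p.re - z.im * p.im)),
    mul_nonneg (sq_nonneg z.re) (sq_nonneg p.re), sq_nonneg (z.re * p.re - z.im * p.im),
    sq_nonneg p.re, mul_nonneg (sq_nonneg z.im) (sq_nonneg p.re)]

lemma disp_translation_sq (x : ℂ) : disp s f (translation x) ^ 2 =
    ∫ α, ‖Complex.exp ((s * comp x α : ℝ) * Complex.I) - 1‖ ^ 2 * ‖f α‖ ^ 2 := by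
  rw [disp, l2_sq]
  refine integral_congr_ae (ae_of_all _ fun α => ?_)
  simp only [ContinuousMap.sub_apply, act_translation_apply]
  rw [← mul_pow, ← norm_mul, sub_mul, one_mul]

/-- Two translations in different directions cannot both almost fix `f`. -/
lemma l2_le_disp_translation {z x : ℂ} (hz : ‖z‖ = 1) (hs : 0 ≤ s) (hx : s * ‖x‖ ≤ 1) :
    (s * ‖x‖) ^ 2 * z.im ^ 2 * l2 f ^ 2 ≤
      12 * (disp s f (translation x) ^ 2 + disp s f (translation (z * x)) ^ 2) := by
  have hpt : ∀ y : ℂ, s * ‖y‖ ≤ 1 → ∀ α : 𝕋,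
      (s * comp y α) ^ 2 / 4 ≤ ‖Complex.exp ((s * comp y α : ℝ) * Complex.I) - 1‖ ^ 2 := by
    intro y hy α
    have h1 : |s * comp y α| ≤ 1 := by
      rw [abs_mul, abs_of_nonneg hs]
      exact (mul_le_mul_of_nonneg_left (abs_comp_le y α) hs).trans hy
    have h2 := pow_le_pow_left₀ (by positivity) (half_abs_le_norm_exp_sub_one h1) 2
    rw [div_pow, sq_abs] at h2
    linarith
  have hzx : s * ‖z * x‖ ≤ 1 := by rwa [norm_mul, hz, one_mul]
  rw [disp_translation_sq, disp_translation_sq, l2_sq, ← integral_const_mul, ← integral_add,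
    ← integral_const_mul]
  · apply integral_mono
    · exact integrable_circle (by fun_prop)
    · exact integrable_circle (by fun_prop)
    · intro α
      dsimp only
      have h1 := hpt x hx α
      have h2 := hpt (z * x) hzx α
      have h3 := mul_le_mul_of_nonneg_left (sq_im_mul_sq_norm_le z x hz α) (sq_nonneg s)
      rw [← add_mul, ← mul_assoc]
      apply mul_le_mul_of_nonneg_right _ (sq_nonneg _)
      nlinarith
  · exact integrable_circle (by fun_prop)
  · exact integrable_circle (by fun_prop)

end SpectralGap

/-! ### The spectral gap -/

section GapTheorem

local notation "𝕋" => AddCircle (2 * Real.pi)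

/-- The finitely supported step distributions considered here: `w` gives the weights of the steps
in `S`, and `g₀` is a step with an arithmetically generic rotation. -/
structure IsGenericWalk (S : Finset rigidMotions) (w : rigidMotions → ℝ) (g₀ : rigidMotions) :
    Prop where
  pos : ∀ g ∈ S, 0 < w g
  sum_eq_one : ∑ g ∈ S, w g = 1
  inv_mem : ∀ g ∈ S, g⁻¹ ∈ S
  drift_eq_zero : ∑ g ∈ S, (w g : ℂ) * trans g = 0
  mem : g₀ ∈ S
  exists_relation : ∃ A B : ℤ, 2 ≤ B ∧ IsCoprime A B ∧
    (B : ℂ) * rot (g₀ * g₀) ^ 2 = A * rot (g₀ * g₀) - B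
  im_ne_zero : (rot (g₀ * g₀)).im ≠ 0
  exists_trans_ne_zero : ∃ g ∈ S, trans g ≠ 0

variable {S : Finset rigidMotions} {w : rigidMotions → ℝ} {g₀ : rigidMotions}

lemma IsGenericWalk.rot_sq_ne_one (H : IsGenericWalk S w g₀) : rot g₀ ^ 2 ≠ 1 := by
  intro h
  apply H.im_ne_zero
  rw [rot_mul, ← sq, h, Complex.one_im]

lemma IsGenericWalk.exists_weight_lower_bound (H : IsGenericWalk S w g₀) :
    ∃ m : ℝ, 0 < m ∧ ∀ g ∈ S, m ≤ w g := by
  obtain ⟨g, hg, hmin⟩ := S.exists_min_image w ⟨g₀, H.mem⟩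
  exact ⟨w g, H.pos g hg, hmin⟩

/-- If averaging loses only `E` of the squared norm, every quotient of two steps moves `f` by at
most a multiple `δ` of `√E`. The digit expansion then yields translations of length `‖v‖ / B ^ k` in
two directions that move `f` by `O(k δ)`, and `l2_le_disp_translation` bounds such displacements
from below. -/
lemma IsGenericWalk.exists_gap_at_scale (H : IsGenericWalk S w g₀) :
    ∃ c : ℝ, 0 < c ∧ ∃ V : ℝ, 0 < V ∧ ∃ B : ℝ, 2 ≤ B ∧ ∀ (s : ℝ) (k : ℕ) (f : C(𝕋, ℂ)), 0 ≤ s →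
      s * V ≤ B ^ k →
      c * (s * V / B ^ k) ^ 2 / (k + 1) ^ 2 * l2 f ^ 2 ≤ l2 f ^ 2 - l2 (avg s S w f) ^ 2 := by
  obtain ⟨m, hm, hmw⟩ := H.exists_weight_lower_bound
  obtain ⟨A, B, hB, hAB, hrel⟩ := H.exists_relation
  obtain ⟨a, ha, b, hb, hv⟩ := exists_commutator_ne_zero H.pos H.inv_mem H.drift_eq_zero H.mem
    H.rot_sq_ne_one H.exists_trans_ne_zero
  set h := g₀ * g₀ with hh
  set v := (rot h - 1) * trans (a⁻¹ * b) - (rot (a⁻¹ * b) - 1) * trans h with hvdef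
  set z := rot h with hzdef
  have hz : ‖z‖ = 1 := norm_rot h
  have him : z.im ≠ 0 := H.im_ne_zero
  have hB1 : (2 : ℝ) ≤ B := by exact_mod_cast hB
  -- The factor `6` is `4 + 2`: the commutator translation costs `4 δ`, a conjugation by `h` costs
  -- `2 δ`.
  set K : ℝ := 10 * B * (1 + 2 / |z.im|) * 6 with hK
  have hK2 : 2 ≤ K := by
    have : 0 ≤ 2 / |z.im| := by positivity
    nlinarith
  -- Here `120 = 2 · 12 · (1 + 2²)`: the variance identity, the constant of
  -- `l2_le_disp_translation`, and the displacements of `x` and `z x`.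
  refine ⟨m ^ 2 * z.im ^ 2 / (120 * K ^ 2), by positivity, ‖v‖, norm_pos_iff.mpr hv, B, hB1, ?_⟩
  intro s k f hs hsk
  set E := l2 f ^ 2 - l2 (avg s S w f) ^ 2 with hE
  have hpair : ∀ g ∈ S, ∀ g' ∈ S, disp s f (g'⁻¹ * g) ^ 2 ≤ 2 * E / m ^ 2 := by
    intro g hg g' hg'
    rw [disp_inv_mul, le_div_iff₀ (by positivity)]
    have h1 := l2_act_sub_act_le (s := s) H.pos H.sum_eq_one f hg hg'
    have h2 : m ^ 2 ≤ w g * w g' := by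
      rw [sq]; exact mul_le_mul (hmw g hg) (hmw g' hg') hm.le (H.pos g hg).le
    nlinarith [sq_nonneg (l2 (act s g f - act s g' f))]
  have hE0 : 0 ≤ 2 * E / m ^ 2 := (sq_nonneg _).trans (hpair g₀ H.mem g₀ H.mem)
  set δ := √(2 * E / m ^ 2) with hδ
  have hδ0 : 0 ≤ δ := Real.sqrt_nonneg _
  have hpair' : ∀ g ∈ S, ∀ g' ∈ S, disp s f (g'⁻¹ * g) ≤ δ := fun g hg g' hg' =>
    Real.le_sqrt_of_sq_le (hpair g hg g' hg')
  -- `h = (g₀⁻¹)⁻¹ g₀` is itself a quotient of two steps.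
  have hdh : disp s f h ≤ δ := by
    have := hpair' g₀ H.mem g₀⁻¹ (H.inv_mem _ H.mem)
    rwa [inv_inv] at this
  have hdab : disp s f (a⁻¹ * b) ≤ δ := hpair' b hb a ha
  have hdv : disp s f (translation v) ≤ 4 * δ := by
    rw [hvdef, translation_commutator]
    have h1 := disp_mul_le (s := s) (f := f) (h * (a⁻¹ * b) * h⁻¹) (a⁻¹ * b)⁻¹
    have h2 := disp_mul_le (s := s) (f := f) (h * (a⁻¹ * b)) h⁻¹
    have h3 := disp_mul_le (s := s) (f := f) h (a⁻¹ * b)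
    rw [disp_inv] at h1 h2
    linarith
  have hrot : ∀ x, disp s f (translation (z * x)) ≤ disp s f (translation x) + 2 * δ := by
    intro x
    rw [hzdef, translation_rot_mul]
    have h1 := disp_mul_le (s := s) (f := f) (h * translation x) h⁻¹
    have h2 := disp_mul_le (s := s) (f := f) h (translation x)
    rw [disp_inv] at h1
    linarith
  have key := subadditive_contraction_le (L := fun x => disp s f (translation x)) (d := 2 * δ)
    (fun x y => by rw [translation_add]; exact disp_mul_le _ _)
    (by rw [translation_zero]; exact disp_one)
    (fun x => by rw [translation_neg]; exact disp_inv _) hrot (fun x => disp_nonneg _) hz him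
    (by positivity) (show 0 < B by omega) hAB hrel v k
  set x := z ^ k / (B : ℂ) ^ k * v with hx
  have hnx : ‖x‖ = ‖v‖ / (B : ℝ) ^ k := by
    rw [hx, norm_mul, norm_div, norm_pow, norm_pow, hz, one_pow]
    have : ‖(B : ℂ)‖ = B := by
      rw [Complex.norm_intCast, abs_of_nonneg (by linarith)]
    rw [this]; ring
  have hBk : (0 : ℝ) < (B : ℝ) ^ k := by positivity
  have hup : disp s f (translation x) ≤ K * (k + 1) * δ := by
    refine key.trans ?_
    have h1 : 0 ≤ 10 * B * (1 + 2 / |z.im|) * ((k : ℝ) + 1) := by positivity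
    calc _ ≤ 10 * B * (1 + 2 / |z.im|) * ((k : ℝ) + 1) * (6 * δ) :=
          mul_le_mul_of_nonneg_left (by linarith) h1
      _ = _ := by rw [hK]; ring
  have hup2 : disp s f (translation (z * x)) ≤ 2 * (K * (k + 1) * δ) := by
    have h1 := hrot x
    have h2 : 2 * δ ≤ K * (k + 1) * δ := by
      apply mul_le_mul_of_nonneg_right _ hδ0
      nlinarith [k.cast_nonneg (α := ℝ)]
    linarith
  have hlow := l2_le_disp_translation (f := f) (x := x) hz hs
    (by rw [hnx, ← mul_div_assoc, div_le_one hBk]; exact hsk)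
  rw [hnx, ← mul_div_assoc] at hlow
  have h3 : disp s f (translation x) ^ 2 ≤ (K * (k + 1) * δ) ^ 2 :=
    pow_le_pow_left₀ (disp_nonneg _) hup 2
  have h4 : disp s f (translation (z * x)) ^ 2 ≤ (2 * (K * (k + 1) * δ)) ^ 2 :=
    pow_le_pow_left₀ (disp_nonneg _) hup2 2
  have h5 : δ ^ 2 = 2 * E / m ^ 2 := Real.sq_sqrt hE0
  have h6 : (s * ‖v‖ / (B : ℝ) ^ k) ^ 2 * z.im ^ 2 * l2 f ^ 2 ≤
      60 * K ^ 2 * (k + 1) ^ 2 * (2 * E / m ^ 2) := by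
    rw [← h5]; nlinarith
  have h7 : m ^ 2 * z.im ^ 2 / (120 * K ^ 2) * (s * ‖v‖ / (B : ℝ) ^ k) ^ 2 / (k + 1) ^ 2 * l2 f ^ 2
      = (s * ‖v‖ / (B : ℝ) ^ k) ^ 2 * z.im ^ 2 * l2 f ^ 2 *
        (m ^ 2 / (120 * K ^ 2 * (k + 1) ^ 2)) := by
    field_simp
  rw [h7]
  calc _ ≤ 60 * K ^ 2 * (k + 1) ^ 2 * (2 * E / m ^ 2) * (m ^ 2 / (120 * K ^ 2 * (k + 1) ^ 2)) :=
        mul_le_mul_of_nonneg_right h6 (by positivity)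
    _ = E := by field_simp; ring

lemma le_exp_mul_of_mul_sq_le {x y t : ℝ} (hx : 0 ≤ x)
    (h : t * x ^ 2 ≤ x ^ 2 - y ^ 2) : y ≤ Real.exp (-(t / 2)) * x := by
  have h1 : y ^ 2 ≤ (Real.exp (-(t / 2)) * x) ^ 2 := by
    have h2 : 1 - t ≤ Real.exp (-t) := by linarith [Real.add_one_le_exp (-t)]
    have h3 : Real.exp (-(t / 2)) ^ 2 = Real.exp (-t) := by
      rw [← Real.exp_nat_mul]; congr 1; push_cast; ring
    rw [mul_pow, h3]
    nlinarith [sq_nonneg x]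
  exact le_of_sq_le_sq h1 (by positivity)

/-- The spectral gap of the averaging operators: quadratic at small radii, and of order
`(1 + log s)⁻²` at large ones. -/
theorem IsGenericWalk.exists_spectral_gap (H : IsGenericWalk S w g₀) :
    ∃ c : ℝ, 0 < c ∧ ∃ s₀ : ℝ, 0 < s₀ ∧ s₀ ≤ 1 ∧
      (∀ s : ℝ, 0 ≤ s → s ≤ s₀ → ∀ f : C(𝕋, ℂ),
        l2 (avg s S w f) ≤ Real.exp (-(c * s ^ 2)) * l2 f) ∧
      (∀ R s : ℝ, s₀ ≤ s → s ≤ R → 1 ≤ R → ∀ f : C(𝕋, ℂ),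
        l2 (avg s S w f) ≤ Real.exp (-(c / (1 + Real.log R) ^ 2)) * l2 f) := by
  obtain ⟨c, hc, V, hV, B, hB, hgap⟩ := H.exists_gap_at_scale
  -- Up to `s₀` the translation `v` needs no contraction: `k = 0` is admissible.
  set s₀ : ℝ := min 1 (1 / V) with hs₀
  have hs₀pos : 0 < s₀ := lt_min one_pos (by positivity)
  have hs₀V : s₀ * V ≤ 1 := by
    calc s₀ * V ≤ 1 / V * V := mul_le_mul_of_nonneg_right (min_le_right _ _) hV.le
      _ = 1 := by field_simp
  have hlog2 : (1 : ℝ) / 2 ≤ Real.log 2 := by linarith [Real.log_two_gt_d9]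
  set D : ℝ := 4 + 2 * |Real.log V| with hD
  have hD4 : 4 ≤ D := by
    have := abs_nonneg (Real.log V)
    linarith
  set c' : ℝ := c * (min (s₀ * V) (1 / B)) ^ 2 / D ^ 2 / 2 with hc'
  have hmin : 0 < min (s₀ * V) (1 / B) := lt_min (by positivity) (by positivity)
  refine ⟨min (c * V ^ 2 / 2) c', lt_min (by positivity) (by positivity), s₀, hs₀pos,
    min_le_left _ _, ?_, ?_⟩
  · intro s hs hss f
    have h1 := hgap s 0 f hs (by
      rw [pow_zero]; exact (mul_le_mul_of_nonneg_right hss hV.le).trans hs₀V)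
    have h2 := le_exp_mul_of_mul_sq_le (l2_nonneg f) h1
    refine h2.trans (mul_le_mul_of_nonneg_right (Real.exp_le_exp.mpr ?_) (l2_nonneg f))
    have h3 := mul_le_mul_of_nonneg_right (min_le_left (c * V ^ 2 / 2) c') (sq_nonneg s)
    simp only [pow_zero, div_one, Nat.cast_zero, zero_add, one_pow]
    nlinarith
  · intro R s hs hsR hR f
    have hspos : 0 < s := hs₀pos.trans_le hs
    have hlogR : 0 ≤ Real.log R := Real.log_nonneg hR
    -- `B ^ k` is taken just above `s V`, so that the contracted translation has size about `1 / s`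
    -- and `k = O(1 + log R)`.
    obtain ⟨k, hk1, hk2, hk3⟩ : ∃ k : ℕ, s * V ≤ B ^ k ∧ min (s₀ * V) (1 / B) ≤ s * V / B ^ k ∧
        (k + 1 : ℝ) ≤ D * (1 + Real.log R) := by
      rcases le_or_gt (s * V) 1 with h | h
      · refine ⟨0, by simpa using h, ?_, ?_⟩
        · rw [pow_zero, div_one]
          exact (min_le_left _ _).trans (mul_le_mul_of_nonneg_right hs hV.le)
        · simp only [Nat.cast_zero]; nlinarith
      · obtain ⟨n, hn1, hn2⟩ := exists_nat_pow_near h.le (show 1 < B by linarith)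
        refine ⟨n + 1, hn2.le, (min_le_right _ _).trans ?_, ?_⟩
        · rw [pow_succ, div_le_div_iff₀ (by linarith) (by positivity)]
          nlinarith
        · have h1 : (n : ℝ) * Real.log 2 ≤ Real.log R + |Real.log V| := by
            have h2 : Real.log ((2 : ℝ) ^ n) ≤ Real.log (R * V) := by
              apply Real.log_le_log (by positivity)
              calc (2 : ℝ) ^ n ≤ B ^ n := pow_le_pow_left₀ (by norm_num) hB n
                _ ≤ s * V := hn1
                _ ≤ R * V := mul_le_mul_of_nonneg_right hsR hV.le
            rw [Real.log_pow, Real.log_mul (by linarith) hV.ne'] at h2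
            linarith [le_abs_self (Real.log V)]
          have h3 : (n : ℝ) ≤ 2 * (Real.log R + |Real.log V|) := by
            nlinarith [n.cast_nonneg (α := ℝ)]
          push_cast
          rw [hD]
          nlinarith [abs_nonneg (Real.log V), mul_nonneg (abs_nonneg (Real.log V)) hlogR]
    have h2 := le_exp_mul_of_mul_sq_le (l2_nonneg f) (hgap s k f hspos.le hk1)
    refine h2.trans (mul_le_mul_of_nonneg_right (Real.exp_le_exp.mpr ?_) (l2_nonneg f))
    rw [neg_le_neg_iff]
    have hR1 : 0 < 1 + Real.log R := by linarith
    calc min (c * V ^ 2 / 2) c' / (1 + Real.log R) ^ 2 ≤ c' / (1 + Real.log R) ^ 2 := by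
          gcongr; exact min_le_right _ _
      _ = c * (min (s₀ * V) (1 / B)) ^ 2 / (D * (1 + Real.log R)) ^ 2 / 2 := by
          rw [hc']; field_simp
      _ ≤ c * (s * V / B ^ k) ^ 2 / (k + 1) ^ 2 / 2 := by gcongr

end GapTheorem

/-! ### Perturbation theory at low frequency -/

section LowFrequency

local notation "𝕋" => AddCircle (2 * Real.pi)

lemma norm_exp_sub_taylor_two_le (t : ℝ) :
    ‖Complex.exp (t * Complex.I) - 1 - t * Complex.I + t ^ 2 / 2‖ ≤ 4 * |t| ^ 3 := by
  rcases le_or_gt |t| 1 with h | h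
  · have h1 := Complex.exp_bound (x := t * Complex.I) (by simpa using h) (n := 3) (by norm_num)
    simp only [Finset.sum_range_succ, Finset.sum_range_zero] at h1
    have e : Complex.exp (t * Complex.I) - 1 - t * Complex.I + t ^ 2 / 2 =
        Complex.exp (t * Complex.I) - (0 + (t * Complex.I) ^ 0 / (Nat.factorial 0 : ℕ) +
          (t * Complex.I) ^ 1 / (Nat.factorial 1 : ℕ) +
          (t * Complex.I) ^ 2 / (Nat.factorial 2 : ℕ)) := by
      simp only [Nat.factorial, mul_pow, Complex.I_sq]
      push_cast
      ring
    rw [e]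
    refine h1.trans ?_
    have h2 : ‖(t : ℂ) * Complex.I‖ = |t| := by simp
    rw [h2]
    have h3 : 0 ≤ |t| ^ 3 := by positivity
    norm_num [Nat.factorial]
    nlinarith
  · have h1 : ‖Complex.exp (t * Complex.I) - 1 - t * Complex.I + t ^ 2 / 2‖ ≤
        1 + 1 + |t| + |t| ^ 2 / 2 := by
      refine (norm_add_le _ _).trans (add_le_add ((norm_sub_le _ _).trans (add_le_add
        ((norm_sub_le _ _).trans (add_le_add ?_ ?_)) ?_)) ?_)
      · rw [Complex.norm_exp_ofReal_mul_I]
      · simp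
      · simp
      · simp
    have h2 : |t| ^ 2 ≤ |t| ^ 3 := pow_le_pow_right₀ h.le (by norm_num)
    nlinarith

lemma norm_exp_mul_I_sub_one_le (t : ℝ) : ‖Complex.exp (t * Complex.I) - 1‖ ≤ |t| := by
  have := Real.norm_exp_I_mul_ofReal_sub_one_le (x := t)
  rwa [mul_comm, Real.norm_eq_abs] at this

/-- The trigonometric polynomial `Re (a e^{2iα})`. -/
def corrector (a : ℂ) : C(𝕋, ℂ) :=
  ⟨fun α => ((a * phase α ^ 2).re : ℝ), by fun_prop⟩

lemma corrector_apply (a : ℂ) (α : 𝕋) : corrector a α = ((a * phase α ^ 2).re : ℝ) := rfl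

lemma norm_corrector_le (a : ℂ) (α : 𝕋) : ‖corrector a α‖ ≤ ‖a‖ := by
  rw [corrector_apply, Complex.norm_real]
  exact (Complex.abs_re_le_norm _).trans (by simp)

lemma corrector_sub_ang (a : ℂ) (g : rigidMotions) (α : 𝕋) :
    corrector a (α - ang g) = ((a * rot (g⁻¹ * g⁻¹) * phase α ^ 2).re : ℝ) := by
  rw [corrector_apply, sub_eq_add_neg, phase_add, phase_neg, phase_ang, rot_mul, rot_inv]
  congr 2
  ring

/-- The second-order term of `T_s 1` is thus a constant plus a pure second harmonic; only the latter
needs a corrector. -/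
lemma comp_sq (v : ℂ) (α : 𝕋) :
    comp v α ^ 2 = ‖v‖ ^ 2 / 2 + ((starRingEnd ℂ) v ^ 2 * phase α ^ 2).re / 2 := by
  set p := phase α * (starRingEnd ℂ) v with hp
  have h1 : ‖v‖ ^ 2 = p.re ^ 2 + p.im ^ 2 := by
    have h2 : ‖v‖ = ‖p‖ := by simp [hp]
    rw [h2, ← Complex.normSq_eq_norm_sq, Complex.normSq_apply]; ring
  have h3 : (starRingEnd ℂ) v ^ 2 * phase α ^ 2 = p * p := by rw [hp]; ring
  rw [h1, h3, Complex.mul_re p p, show comp v α = p.re from rfl]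
  ring

variable {S : Finset rigidMotions} {w : rigidMotions → ℝ} {g₀ : rigidMotions}

/-- The variance parameter `σ²`. -/
def variance (S : Finset rigidMotions) (w : rigidMotions → ℝ) : ℝ :=
  1 / 2 * ∑ g ∈ S, w g * ‖trans g‖ ^ 2

lemma IsGenericWalk.variance_pos (H : IsGenericWalk S w g₀) : 0 < variance S w := by
  obtain ⟨g, hg, hne⟩ := H.exists_trans_ne_zero
  have : 0 < ∑ g ∈ S, w g * ‖trans g‖ ^ 2 := by
    apply Finset.sum_pos' (fun g hg => mul_nonneg (H.pos g hg).le (sq_nonneg _))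
    have := norm_pos_iff.mpr hne
    exact ⟨g, hg, mul_pos (H.pos g hg) (by positivity)⟩
  unfold variance
  linarith

/-- A mean of unit complex numbers is `1` only if each of them is. The sum is the eigenvalue of the
averaged rotations on the second harmonic, so the corrector equation is solvable. -/
lemma IsGenericWalk.sum_rot_ne_one (H : IsGenericWalk S w g₀) :
    ∑ g ∈ S, (w g : ℂ) * rot (g⁻¹ * g⁻¹) ≠ 1 := by
  intro h
  have h1 : ∑ g ∈ S, w g * (1 - (rot (g⁻¹ * g⁻¹)).re) = 0 := by
    have := congrArg Complex.re h
    simp only [Complex.re_sum, Complex.re_ofReal_mul, Complex.one_re] at this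
    simp only [mul_sub, mul_one, Finset.sum_sub_distrib, H.sum_eq_one, this, sub_self]
  have h2 := (Finset.sum_eq_zero_iff_of_nonneg fun g hg =>
    mul_nonneg (H.pos g hg).le (by linarith [re_rot_le_one (g⁻¹ * g⁻¹)])).mp h1 g₀ H.mem
  have h3 : (rot (g₀⁻¹ * g₀⁻¹)).re = 1 := by
    have := (mul_eq_zero.mp h2).resolve_left (H.pos g₀ H.mem).ne'
    linarith
  have h4 := eq_one_of_re_rot_eq_one h3
  rw [rot_mul, rot_inv, ← sq, inv_pow, inv_eq_one] at h4
  exact H.rot_sq_ne_one h4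

/-- The second-order terms cancel for a suitable corrector. -/
lemma IsGenericWalk.exists_corrector (H : IsGenericWalk S w g₀) : ∃ a : ℂ, ∀ α : 𝕋,
    ∑ g ∈ S, (w g : ℂ) * corrector a (α - ang g) - corrector a α =
      ∑ g ∈ S, (w g : ℂ) * (comp (trans g) α : ℂ) ^ 2 / 2 - (variance S w : ℂ) / 2 := by
  set l := ∑ g ∈ S, (w g : ℂ) * rot (g⁻¹ * g⁻¹) with hl
  have hl1 : l - 1 ≠ 0 := sub_ne_zero.mpr H.sum_rot_ne_one
  set m := ∑ g ∈ S, (w g : ℂ) * (starRingEnd ℂ) (trans g) ^ 2 with hm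
  -- The equation reads `a (l - 1) = m / 4`, with one `1/2` from the Taylor expansion and one from
  -- `comp_sq`.
  refine ⟨m / (4 * (l - 1)), fun α => ?_⟩
  set a := m / (4 * (l - 1)) with ha
  have ham : a * (l - 1) = m / 4 := by rw [ha]; field_simp
  have h1 : ∑ g ∈ S, w g * (a * rot (g⁻¹ * g⁻¹) * phase α ^ 2).re = (a * l * phase α ^ 2).re := by
    rw [hl, Finset.mul_sum, Finset.sum_mul, Complex.re_sum]
    refine Finset.sum_congr rfl fun g _ => ?_
    rw [← Complex.re_ofReal_mul]; congr 1; ring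
  have h2 : ∑ g ∈ S, w g * ((starRingEnd ℂ) (trans g) ^ 2 * phase α ^ 2).re =
      (m * phase α ^ 2).re := by
    rw [hm, Finset.sum_mul, Complex.re_sum]
    refine Finset.sum_congr rfl fun g _ => ?_
    rw [← Complex.re_ofReal_mul]; congr 1; ring
  have h3 : ∑ g ∈ S, w g * comp (trans g) α ^ 2 / 2 =
      variance S w / 2 + (m * phase α ^ 2).re / 4 := by
    rw [← h2, variance, Finset.sum_div, Finset.mul_sum, Finset.sum_div, ← Finset.sum_add_distrib]
    refine Finset.sum_congr rfl fun g _ => ?_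
    rw [comp_sq]; ring
  have h4 : (a * l * phase α ^ 2).re - (a * phase α ^ 2).re = (m * phase α ^ 2).re / 4 := by
    have : a * l * phase α ^ 2 - a * phase α ^ 2 = m * phase α ^ 2 / 4 := by
      linear_combination phase α ^ 2 * ham
    rw [← Complex.sub_re, this]
    simp
  simp only [corrector_sub_ang]
  rw [corrector_apply]
  have h5 : ∑ g ∈ S, w g * (a * rot (g⁻¹ * g⁻¹) * phase α ^ 2).re - (a * phase α ^ 2).re =
      ∑ g ∈ S, w g * comp (trans g) α ^ 2 / 2 - variance S w / 2 := by
    rw [h1, h3]; linarith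
  exact_mod_cast congrArg (fun t : ℝ => (t : ℂ)) h5

lemma IsGenericWalk.sum_comp_eq_zero (H : IsGenericWalk S w g₀) (α : 𝕋) :
    ∑ g ∈ S, (w g : ℂ) * (comp (trans g) α : ℂ) = 0 := by
  have h1 : ∑ g ∈ S, w g * comp (trans g) α = 0 := by
    have h2 := congrArg (fun x => (phase α * (starRingEnd ℂ) x).re) H.drift_eq_zero
    simp only [map_sum, map_mul, Complex.conj_ofReal, Finset.mul_sum, Complex.re_sum, map_zero,
      mul_zero, Complex.zero_re] at h2
    rw [← h2]
    refine Finset.sum_congr rfl fun g _ => ?_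
    rw [comp, ← Complex.re_ofReal_mul]; congr 1; ring
  exact_mod_cast congrArg (fun t : ℝ => (t : ℂ)) h1

lemma abs_exp_neg_sub_one_sub_le {x : ℝ} (hx : 0 ≤ x) : |Real.exp (-x) - (1 - x)| ≤ x ^ 2 := by
  rw [abs_of_nonneg (by linarith [Real.add_one_le_exp (-x)])]
  have h1 : Real.exp (-x) ≤ (1 + x)⁻¹ := by
    rw [Real.exp_neg]
    exact inv_anti₀ (by linarith) (by linarith [Real.add_one_le_exp x])
  have h2 : (1 + x)⁻¹ ≤ 1 - x + x ^ 2 := by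
    rw [inv_le_iff_one_le_mul₀ (by linarith)]
    nlinarith [pow_nonneg hx 3]
  linarith

/-- `1 + s² · corrector` is an approximate eigenvector of the averaging operator. -/
lemma IsGenericWalk.exists_approx_eigenvector (H : IsGenericWalk S w g₀) :
    ∃ a : ℂ, ∃ C : ℝ, 0 < C ∧ ∀ s : ℝ, 0 ≤ s → s ≤ 1 → ∀ α : 𝕋,
      ‖avg s S w (1 + ((s ^ 2 : ℝ) : ℂ) • corrector a) α -
        (Real.exp (-(variance S w / 2 * s ^ 2)) : ℂ) *
          (1 + ((s ^ 2 : ℝ) : ℂ) • corrector a : C(𝕋, ℂ)) α‖ ≤ C * s ^ 3 := by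
  obtain ⟨a, ha⟩ := H.exists_corrector
  obtain ⟨M, hM⟩ := (S.finite_toSet.image fun g => ‖trans g‖).bddAbove
  replace hM : ∀ g ∈ S, ‖trans g‖ ≤ M := fun g hg => hM ⟨g, hg, rfl⟩
  have hM0 : 0 ≤ M := (norm_nonneg _).trans (hM g₀ H.mem)
  set V := variance S w with hV
  have hVpos : 0 < V := H.variance_pos
  refine ⟨a, 4 * M ^ 3 + M * ‖a‖ + V / 2 * ‖a‖ + (V / 2) ^ 2 * (1 + ‖a‖), by positivity,
    fun s hs hs1 α => ?_⟩
  set q : rigidMotions → ℂ := fun g => corrector a (α - ang g) with hq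
  set e : rigidMotions → ℂ := fun g => Complex.exp ((s * comp (trans g) α : ℝ) * Complex.I) with he
  set t : rigidMotions → ℝ := fun g => s * comp (trans g) α with ht
  set E : ℝ := Real.exp (-(V / 2 * s ^ 2)) with hE
  -- The first-order term vanishes by zero drift, the second-order terms cancel through the
  -- corrector; the four remainders are `O(s³)` or `O(s⁴)`.
  have hsplit : avg s S w (1 + ((s ^ 2 : ℝ) : ℂ) • corrector a) α -
      (E : ℂ) * (1 + ((s ^ 2 : ℝ) : ℂ) • corrector a : C(𝕋, ℂ)) α =
      ∑ g ∈ S, (w g : ℂ) * (e g - 1 - t g * Complex.I + t g ^ 2 / 2) +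
      s ^ 2 * ∑ g ∈ S, (w g : ℂ) * ((e g - 1) * q g) + s ^ 4 * (V / 2) * corrector a α -
      ((E - (1 - V / 2 * s ^ 2) : ℝ) : ℂ) * (1 + s ^ 2 * corrector a α) := by
    have h1 : avg s S w (1 + ((s ^ 2 : ℝ) : ℂ) • corrector a) α =
        ∑ g ∈ S, (w g : ℂ) * (e g * (1 + s ^ 2 * q g)) := by
      rw [avg_apply]
      refine Finset.sum_congr rfl fun g _ => ?_
      rw [act_apply]
      simp [he, hq]
    have h2 : (1 + ((s ^ 2 : ℝ) : ℂ) • corrector a : C(𝕋, ℂ)) α = 1 + s ^ 2 * corrector a α := by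
      simp
    have h3 : ∑ g ∈ S, (w g : ℂ) * (e g - 1 - t g * Complex.I + t g ^ 2 / 2) =
        ∑ g ∈ S, (w g : ℂ) * e g - 1 + s ^ 2 * ∑ g ∈ S, (w g : ℂ) * comp (trans g) α ^ 2 / 2 := by
      have h4 : ∑ g ∈ S, (w g : ℂ) = 1 := by exact_mod_cast H.sum_eq_one
      have h5 := H.sum_comp_eq_zero α
      have h6 : ∑ g ∈ S, (w g : ℂ) * (e g - 1 - t g * Complex.I + t g ^ 2 / 2) =
          ∑ g ∈ S, (w g : ℂ) * e g - ∑ g ∈ S, (w g : ℂ) -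
          s * Complex.I * ∑ g ∈ S, (w g : ℂ) * comp (trans g) α +
          s ^ 2 * ∑ g ∈ S, (w g : ℂ) * comp (trans g) α ^ 2 / 2 := by
        rw [Finset.mul_sum, Finset.mul_sum, ← Finset.sum_sub_distrib, ← Finset.sum_sub_distrib,
          ← Finset.sum_add_distrib]
        refine Finset.sum_congr rfl fun g _ => ?_
        simp only [ht]; push_cast; ring
      rw [h6, h4, h5]; ring
    have h7 : ∑ g ∈ S, (w g : ℂ) * (e g * (1 + s ^ 2 * q g)) =
        ∑ g ∈ S, (w g : ℂ) * e g + s ^ 2 * (∑ g ∈ S, (w g : ℂ) * ((e g - 1) * q g)) +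
          s ^ 2 * ∑ g ∈ S, (w g : ℂ) * q g := by
      rw [Finset.mul_sum, Finset.mul_sum, ← Finset.sum_add_distrib, ← Finset.sum_add_distrib]
      exact Finset.sum_congr rfl fun g _ => by ring
    have h8 := ha α
    rw [h1, h2, h3, h7]
    push_cast
    linear_combination (s : ℂ) ^ 2 * h8
  have hw : ∀ (F : rigidMotions → ℂ) (c : ℝ), (∀ g ∈ S, ‖F g‖ ≤ c) →
      ‖∑ g ∈ S, (w g : ℂ) * F g‖ ≤ c := by
    intro F c hF
    calc ‖∑ g ∈ S, (w g : ℂ) * F g‖ ≤ ∑ g ∈ S, w g * c := by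
          refine norm_sum_le_of_le _ fun g hg => ?_
          rw [norm_mul, Complex.norm_real, Real.norm_of_nonneg (H.pos g hg).le]
          exact mul_le_mul_of_nonneg_left (hF g hg) (H.pos g hg).le
      _ = c := by rw [← Finset.sum_mul, H.sum_eq_one, one_mul]
  have htM : ∀ g ∈ S, |t g| ≤ s * M := by
    intro g hg
    rw [ht]; dsimp only
    rw [abs_mul, abs_of_nonneg hs]
    exact mul_le_mul_of_nonneg_left ((abs_comp_le _ _).trans (hM g hg)) hs
  have b1 : ‖∑ g ∈ S, (w g : ℂ) * (e g - 1 - t g * Complex.I + t g ^ 2 / 2)‖ ≤ 4 * (s * M) ^ 3 := by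
    refine hw _ _ fun g hg => (norm_exp_sub_taylor_two_le (t g)).trans ?_
    have := pow_le_pow_left₀ (abs_nonneg _) (htM g hg) 3
    linarith
  have b2 : ‖∑ g ∈ S, (w g : ℂ) * ((e g - 1) * q g)‖ ≤ s * M * ‖a‖ := by
    refine hw _ _ fun g hg => ?_
    rw [norm_mul]
    exact mul_le_mul ((norm_exp_mul_I_sub_one_le (t g)).trans (htM g hg)) (norm_corrector_le _ _)
      (norm_nonneg _) (by positivity)
  have b3 := norm_corrector_le a α
  have b4 : ‖((E - (1 - V / 2 * s ^ 2) : ℝ) : ℂ)‖ ≤ (V / 2 * s ^ 2) ^ 2 := by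
    rw [Complex.norm_real]
    exact abs_exp_neg_sub_one_sub_le (by positivity)
  have b5 : ‖1 + (s : ℂ) ^ 2 * corrector a α‖ ≤ 1 + ‖a‖ := by
    refine (norm_add_le _ _).trans (add_le_add (by simp) ?_)
    rw [norm_mul, norm_pow, Complex.norm_real, Real.norm_of_nonneg hs]
    calc s ^ 2 * ‖corrector a α‖ ≤ 1 * ‖a‖ :=
          mul_le_mul (pow_le_one₀ hs hs1) b3 (norm_nonneg _) (by norm_num)
      _ = _ := one_mul _
  have hs34 : s ^ 4 ≤ s ^ 3 := pow_le_pow_of_le_one hs hs1 (by norm_num)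
  rw [hsplit]
  calc _ ≤ 4 * (s * M) ^ 3 + s ^ 2 * (s * M * ‖a‖) + s ^ 4 * (V / 2) * ‖a‖ +
        (V / 2 * s ^ 2) ^ 2 * (1 + ‖a‖) := by
        refine (norm_sub_le _ _).trans (add_le_add ((norm_add_le _ _).trans (add_le_add
          ((norm_add_le _ _).trans (add_le_add b1 ?_)) ?_)) ?_)
        · rw [norm_mul, norm_pow, Complex.norm_real, Real.norm_of_nonneg hs]
          gcongr
        · rw [norm_mul, norm_mul, norm_pow, Complex.norm_real, Real.norm_of_nonneg hs]
          have : ‖(V : ℂ) / 2‖ = V / 2 := by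
            rw [norm_div, Complex.norm_real, Real.norm_of_nonneg hVpos.le]; simp
          rw [this]
          gcongr
        · rw [norm_mul]
          gcongr
    _ = s ^ 3 * (4 * M ^ 3 + M * ‖a‖) + s ^ 4 * (V / 2 * ‖a‖ + (V / 2) ^ 2 * (1 + ‖a‖)) := by ring
    _ ≤ s ^ 3 * (4 * M ^ 3 + M * ‖a‖) + s ^ 3 * (V / 2 * ‖a‖ + (V / 2) ^ 2 * (1 + ‖a‖)) := by
        gcongr
    _ = _ := by ring

end LowFrequency

/-! ### Powers of the averaging operator -/

section Iteration

local notation "𝕋" => AddCircle (2 * Real.pi)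

variable {S : Finset rigidMotions} {w : rigidMotions → ℝ} {g₀ : rigidMotions}

lemma l2_iterate_le {T : C(𝕋, ℂ) →ₗ[ℂ] C(𝕋, ℂ)} {ρ : ℝ} (hρ : 0 ≤ ρ)
    (hT : ∀ f, l2 (T f) ≤ ρ * l2 f) (n : ℕ) (f : C(𝕋, ℂ)) : l2 ((T ^ n) f) ≤ ρ ^ n * l2 f := by
  induction n with
  | zero => simp
  | succ n ih =>
    rw [pow_succ', Module.End.mul_apply, pow_succ', mul_assoc]
    exact (hT _).trans (mul_le_mul_of_nonneg_left ih hρ)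

/-- Telescoping: each of the `n` steps adds an error `e`, damped by `n - 1` factors at most `ρ`. The
factor `ρ` on the left avoids the exponent `n - 1`. -/
lemma l2_iterate_sub_smul_le {T : C(𝕋, ℂ) →ₗ[ℂ] C(𝕋, ℂ)} {ρ l e : ℝ} (hl : 0 ≤ l) (hlρ : l ≤ ρ)
    (hT : ∀ f, l2 (T f) ≤ ρ * l2 f) {F : C(𝕋, ℂ)} (hF : l2 (T F - (l : ℂ) • F) ≤ e) (n : ℕ) :
    ρ * l2 ((T ^ n) F - ((l ^ n : ℝ) : ℂ) • F) ≤ n * ρ ^ n * e := by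
  have hρ : 0 ≤ ρ := hl.trans hlρ
  have he : 0 ≤ e := (l2_nonneg _).trans hF
  induction n with
  | zero => simp [l2_zero]
  | succ n ih =>
    have hsplit : (T ^ (n + 1)) F - ((l ^ (n + 1) : ℝ) : ℂ) • F =
        T ((T ^ n) F - ((l ^ n : ℝ) : ℂ) • F) + ((l ^ n : ℝ) : ℂ) • (T F - (l : ℂ) • F) := by
      rw [pow_succ', Module.End.mul_apply, map_sub, map_smul, smul_sub, smul_smul, pow_succ]
      push_cast
      abel
    have h1 := l2_add_le (T ((T ^ n) F - ((l ^ n : ℝ) : ℂ) • F))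
      (((l ^ n : ℝ) : ℂ) • (T F - (l : ℂ) • F))
    rw [← hsplit, l2_smul, Complex.norm_real, Real.norm_of_nonneg (pow_nonneg hl n)] at h1
    have h2 := hT ((T ^ n) F - ((l ^ n : ℝ) : ℂ) • F)
    have h3 : l ^ n * l2 (T F - (l : ℂ) • F) ≤ ρ ^ n * e :=
      mul_le_mul (pow_le_pow_left₀ hl hlρ n) hF (l2_nonneg _) (pow_nonneg hρ n)
    calc ρ * l2 ((T ^ (n + 1)) F - ((l ^ (n + 1) : ℝ) : ℂ) • F) ≤
        ρ * (ρ * l2 ((T ^ n) F - ((l ^ n : ℝ) : ℂ) • F) + ρ ^ n * e) :=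
          mul_le_mul_of_nonneg_left (by linarith) hρ
      _ ≤ ρ * (n * ρ ^ n * e + ρ ^ n * e) := mul_le_mul_of_nonneg_left (by linarith) hρ
      _ = _ := by push_cast; ring

lemma IsGenericWalk.l2_avg_le (H : IsGenericWalk S w g₀) (s : ℝ) (f : C(𝕋, ℂ)) :
    l2 (avg s S w f) ≤ l2 f := by
  have h1 := l2_act_sub_act_le (s := s) H.pos H.sum_eq_one f H.mem H.mem
  rw [sub_self, l2_zero] at h1
  exact le_of_sq_le_sq (by linarith) (l2_nonneg f)

/-- The difference between the characteristic functions of the walk and of the Gaussian on the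
circle of radius `s`. -/
def charDiff (S : Finset rigidMotions) (w : rigidMotions → ℝ) (n : ℕ) (s : ℝ) : C(𝕋, ℂ) :=
  (avg s S w ^ n) 1 - (Real.exp (-(variance S w / 2 * s ^ 2) * n) : ℂ) • 1

/-- The walk has nearly the characteristic function of the Gaussian, in mean square on circles. -/
theorem IsGenericWalk.exists_l2_charDiff_le (H : IsGenericWalk S w g₀) :
    ∃ c : ℝ, 0 < c ∧ ∃ C : ℝ, 0 < C ∧ ∃ s₀ : ℝ, 0 < s₀ ∧ s₀ ≤ 1 ∧
      (∀ (n : ℕ) (s : ℝ), 0 ≤ s → s ≤ s₀ →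
        l2 (charDiff S w n s) ≤ C * (n * s ^ 3 + s ^ 2) * Real.exp (-(c * n * s ^ 2))) ∧
      (∀ (n : ℕ) (R s : ℝ), s₀ ≤ s → s ≤ R → 1 ≤ R →
        l2 (charDiff S w n s) ≤ C * Real.exp (-(c * n / (1 + Real.log R) ^ 2))) ∧
      (∀ (n : ℕ) (s : ℝ), l2 (charDiff S w n s) ≤ C) := by
  obtain ⟨c₁, hc₁, s₀, hs₀, hs₁, hlow, hhigh⟩ := H.exists_spectral_gap
  obtain ⟨a, C, hC, heig⟩ := H.exists_approx_eigenvector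
  set V := variance S w with hV
  have hVpos : 0 < V := H.variance_pos
  have h1le : l2 (1 : C(𝕋, ℂ)) ≤ 3 := by
    have := l2_le_of_norm_le (f := (1 : C(𝕋, ℂ))) zero_le_one (fun α => by simp)
    linarith
  have hqle : l2 (corrector a) ≤ 3 * ‖a‖ := l2_le_of_norm_le (norm_nonneg a) (norm_corrector_le a)
  -- The second entry makes the Gaussian characteristic function obey the same decay bounds as the
  -- walk, both below and above `s₀`.
  set c := min c₁ (V / 2 * s₀ ^ 2) with hc
  have hcpos : 0 < c := lt_min hc₁ (by positivity)
  have hcV : c ≤ V / 2 := (min_le_right _ _).trans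
    (mul_le_of_le_one_right (by positivity) (pow_le_one₀ hs₀.le hs₁))
  refine ⟨c, hcpos, 3 * C * Real.exp c + 6 * ‖a‖ + 6, by positivity, s₀, hs₀, hs₁, ?_, ?_, ?_⟩
  · intro n s hs hss
    have hs1 : s ≤ 1 := hss.trans hs₁
    set ρ := Real.exp (-(c * s ^ 2)) with hρ
    set E := Real.exp (-(V / 2 * s ^ 2)) with hE
    have hρpos : 0 < ρ := Real.exp_pos _
    have hEρ : E ≤ ρ := Real.exp_le_exp.mpr (neg_le_neg (by gcongr))
    have hT : ∀ f, l2 (avg s S w f) ≤ ρ * l2 f := fun f =>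
      (hlow s hs hss f).trans (mul_le_mul_of_nonneg_right
        (Real.exp_le_exp.mpr (neg_le_neg (by gcongr; exact min_le_left _ _))) (l2_nonneg f))
    set F : C(𝕋, ℂ) := 1 + ((s ^ 2 : ℝ) : ℂ) • corrector a with hF
    have hFe : l2 (avg s S w F - (E : ℂ) • F) ≤ 3 * (C * s ^ 3) :=
      l2_le_of_norm_le (by positivity) (heig s hs hs1)
    have h1 := l2_iterate_sub_smul_le (Real.exp_pos _).le hEρ hT hFe n
    have hρn : ρ ^ n = Real.exp (-(c * n * s ^ 2)) := by
      rw [hρ, ← Real.exp_nat_mul]; congr 1; ring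
    have hEn : E ^ n = Real.exp (-(V / 2 * s ^ 2) * n) := by
      rw [hE, ← Real.exp_nat_mul]; congr 1; ring
    have h2 : l2 ((avg s S w ^ n) F - ((E ^ n : ℝ) : ℂ) • F) ≤
        Real.exp c * (n * ρ ^ n * (3 * (C * s ^ 3))) := by
      have h3 : 1 ≤ Real.exp c * ρ := by
        rw [hρ, ← Real.exp_add]
        exact Real.one_le_exp (by nlinarith [pow_le_one₀ hs hs1 (n := 2)])
      calc l2 ((avg s S w ^ n) F - ((E ^ n : ℝ) : ℂ) • F) ≤
          Real.exp c * ρ * l2 ((avg s S w ^ n) F - ((E ^ n : ℝ) : ℂ) • F) :=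
            le_mul_of_one_le_left (l2_nonneg _) h3
        _ ≤ _ := by rw [mul_assoc]; exact mul_le_mul_of_nonneg_left h1 (Real.exp_pos _).le
    -- The constant `1` is recovered as `F - s² · corrector`; the corrector terms account for the
    -- `s²` in the bound.
    have h3 : charDiff S w n s = ((avg s S w ^ n) F - ((E ^ n : ℝ) : ℂ) • F) -
        ((s ^ 2 : ℝ) : ℂ) • (avg s S w ^ n) (corrector a) +
        ((E ^ n * s ^ 2 : ℝ) : ℂ) • corrector a := by
      rw [charDiff, ← hV, ← hEn, hF, map_add, map_smul, smul_add, smul_smul]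
      push_cast
      abel
    have h4 : l2 (((s ^ 2 : ℝ) : ℂ) • (avg s S w ^ n) (corrector a)) ≤
        s ^ 2 * (ρ ^ n * (3 * ‖a‖)) := by
      rw [l2_smul, Complex.norm_real, Real.norm_of_nonneg (sq_nonneg s)]
      refine mul_le_mul_of_nonneg_left ((l2_iterate_le hρpos.le hT n _).trans ?_) (sq_nonneg s)
      exact mul_le_mul_of_nonneg_left hqle (by positivity)
    have h5 : l2 (((E ^ n * s ^ 2 : ℝ) : ℂ) • corrector a) ≤ ρ ^ n * s ^ 2 * (3 * ‖a‖) := by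
      have hE0 : 0 ≤ E ^ n := pow_nonneg (Real.exp_pos _).le n
      rw [l2_smul, Complex.norm_real, Real.norm_of_nonneg (by positivity)]
      have := pow_le_pow_left₀ (Real.exp_pos _).le hEρ n
      gcongr
      exact l2_nonneg _
    rw [h3, ← hρn]
    have h6 : 0 ≤ ρ ^ n := by positivity
    calc _ ≤ Real.exp c * (n * ρ ^ n * (3 * (C * s ^ 3))) + s ^ 2 * (ρ ^ n * (3 * ‖a‖)) +
          ρ ^ n * s ^ 2 * (3 * ‖a‖) :=
          (l2_add_le _ _).trans (add_le_add ((l2_sub_le _ _).trans (add_le_add h2 h4)) h5)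
      _ = (3 * C * Real.exp c * (n * s ^ 3) + 6 * ‖a‖ * s ^ 2) * ρ ^ n := by ring
      _ ≤ _ := by
          apply mul_le_mul_of_nonneg_right _ h6
          have e1 : 0 ≤ (n : ℝ) * s ^ 3 := by positivity
          have e2 : 0 ≤ s ^ 2 := sq_nonneg s
          have e3 : 0 ≤ 3 * C * Real.exp c := by positivity
          nlinarith [mul_nonneg e3 e2, mul_nonneg (norm_nonneg a) e1]
  · intro n R s hs hsR hR
    have hlogR : 0 ≤ Real.log R := Real.log_nonneg hR
    have hL : 1 ≤ (1 + Real.log R) ^ 2 := one_le_pow₀ (by linarith)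
    set ρ := Real.exp (-(c / (1 + Real.log R) ^ 2)) with hρ
    have hT : ∀ f, l2 (avg s S w f) ≤ ρ * l2 f := fun f =>
      (hhigh R s hs hsR hR f).trans (mul_le_mul_of_nonneg_right
        (Real.exp_le_exp.mpr (neg_le_neg (by gcongr; exact min_le_left _ _))) (l2_nonneg f))
    have h1 := l2_iterate_le (Real.exp_pos _).le hT n 1
    have hρn : ρ ^ n = Real.exp (-(c * n / (1 + Real.log R) ^ 2)) := by
      rw [hρ, ← Real.exp_nat_mul]; congr 1; ring
    have h2 : Real.exp (-(V / 2 * s ^ 2) * n) ≤ ρ ^ n := by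
      rw [hρn]
      apply Real.exp_le_exp.mpr
      rw [neg_mul, neg_le_neg_iff]
      calc c * n / (1 + Real.log R) ^ 2 ≤ c * n := div_le_self (by positivity) hL
        _ ≤ V / 2 * s₀ ^ 2 * n := by gcongr; exact min_le_right _ _
        _ ≤ V / 2 * s ^ 2 * n := by gcongr
    rw [← hρn, charDiff]
    refine (l2_sub_le _ _).trans ?_
    rw [l2_smul, Complex.norm_real, Real.norm_of_nonneg (Real.exp_pos _).le]
    have h6 : 0 ≤ ρ ^ n := by positivity
    have h7 := mul_le_mul_of_nonneg_left h1le h6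
    have h8 : Real.exp (-(V / 2 * s ^ 2) * n) * l2 (1 : C(𝕋, ℂ)) ≤ ρ ^ n * 3 :=
      mul_le_mul h2 h1le (l2_nonneg _) h6
    have h9 : 0 ≤ (3 * C * Real.exp c + 6 * ‖a‖) * ρ ^ n := by positivity
    nlinarith
  · intro n s
    have hT : ∀ f, l2 (avg s S w f) ≤ 1 * l2 f := fun f => by rw [one_mul]; exact H.l2_avg_le s f
    have h1 := l2_iterate_le zero_le_one hT n 1
    rw [one_pow, one_mul] at h1
    rw [charDiff]
    refine (l2_sub_le _ _).trans ?_
    rw [l2_smul, Complex.norm_real, Real.norm_of_nonneg (Real.exp_pos _).le]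
    have h2 : Real.exp (-(V / 2 * s ^ 2) * n) ≤ 1 := Real.exp_le_one_iff.mpr (by
      have : 0 ≤ V / 2 * s ^ 2 * n := by positivity
      linarith)
    have h3 := mul_le_mul h2 h1le (l2_nonneg _) zero_le_one
    have h4 : 0 ≤ 3 * C * Real.exp c + 6 * ‖a‖ := by positivity
    linarith

end Iteration

/-! ### The characteristic function of the walk -/

section Expectation

local notation "𝕋" => AddCircle (2 * Real.pi)

/-- The expectation of a bounded function under a discrete law. -/
def expect {X : Type*} (p : PMF X) (F : X → ℂ) : ℂ := ∑' a, ((p a).toReal : ℂ) * F a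

variable {X Y : Type*}

lemma summable_toReal (p : PMF X) : Summable fun a => (p a).toReal :=
  ENNReal.summable_toReal p.tsum_coe_ne_top

lemma expect_pure (a : X) (F : X → ℂ) : expect (PMF.pure a) F = F a := by
  classical
  rw [expect, tsum_eq_single a]
  · simp
  · intro b hb
    simp [PMF.pure_apply, hb]

lemma expect_bind (p : PMF X) (q : X → PMF Y) {F : Y → ℂ} {M : ℝ} (hF : ∀ b, ‖F b‖ ≤ M) :
    expect (p.bind q) F = expect p fun a => expect (q a) F := by
  have hsum : Summable fun x : X × Y => (p x.1 * q x.1 x.2).toReal := by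
    apply ENNReal.summable_toReal
    rw [ENNReal.tsum_prod']
    simp [ENNReal.tsum_mul_left, PMF.tsum_coe]
  have hsum' : Summable fun x : X × Y => (((p x.1 * q x.1 x.2).toReal : ℝ) : ℂ) * F x.2 := by
    refine Summable.of_norm_bounded (hsum.mul_right M) fun x => ?_
    rw [norm_mul, Complex.norm_real, Real.norm_of_nonneg ENNReal.toReal_nonneg]
    exact mul_le_mul_of_nonneg_left (hF _) ENNReal.toReal_nonneg
  have h1 : ∀ b, (((p.bind q) b).toReal : ℂ) * F b =
      ∑' a, (((p a * q a b).toReal : ℝ) : ℂ) * F b := by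
    intro b
    rw [tsum_mul_right, PMF.bind_apply, ENNReal.tsum_toReal_eq, Complex.ofReal_tsum]
    intro a
    exact ENNReal.mul_ne_top (p.apply_ne_top a) ((q a).apply_ne_top b)
  have h2 : ∀ a, ((p a).toReal : ℂ) * expect (q a) F =
      ∑' b, (((p a * q a b).toReal : ℝ) : ℂ) * F b := by
    intro a
    rw [expect, ← tsum_mul_left]
    refine tsum_congr fun b => ?_
    rw [ENNReal.toReal_mul]; push_cast; ring
  rw [expect, expect, tsum_congr h1, tsum_congr h2]
  exact Summable.tsum_comm (f := fun a b => (((p a * q a b).toReal : ℝ) : ℂ) * F b) hsum'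

lemma expect_map (p : PMF X) (f : X → Y) {F : Y → ℂ} {M : ℝ} (hF : ∀ b, ‖F b‖ ≤ M) :
    expect (p.map f) F = expect p fun a => F (f a) := by
  rw [PMF.map, expect_bind p _ hF]
  simp only [Function.comp_apply, expect_pure]

lemma expect_eq_sum {p : PMF X} (hp : p.support.Finite) (F : X → ℂ) :
    expect p F = ∑ a ∈ hp.toFinset, ((p a).toReal : ℂ) * F a := by
  refine tsum_eq_sum fun a ha => ?_
  rw [Set.Finite.mem_toFinset, PMF.mem_support_iff, not_not] at ha
  simp [ha]

lemma norm_act_apply_le (s : ℝ) (g : rigidMotions) (f : C(𝕋, ℂ)) (α : 𝕋) :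
    ‖act s g f α‖ ≤ ‖f‖ := by
  rw [act_apply, norm_mul, Complex.norm_exp_ofReal_mul_I, one_mul]
  exact f.norm_coe_le_norm _

variable {μ : PMF rigidMotions}

/-- A new step multiplies on the right, so it acts on `f` first and averaging over it replaces `f`
by `avg f`. -/
lemma expect_productLaw_act (hfin : μ.support.Finite) (s : ℝ) (α : 𝕋) (n : ℕ) (f : C(𝕋, ℂ)) :
    expect (productLaw μ n) (fun h => act s h f α) =
      (avg s hfin.toFinset (fun g => (μ g).toReal) ^ n) f α := by
  induction n generalizing f with
  | zero => rw [productLaw, expect_pure, act_one]; rfl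
  | succ n ih =>
    rw [productLaw, expect_bind _ _ (fun h => norm_act_apply_le s h f α), pow_succ,
      Module.End.mul_apply, ← ih]
    congr 1
    ext h
    rw [expect_map _ _ (fun h => norm_act_apply_le s h f α), expect_eq_sum hfin, avg_eq, map_sum,
      ContinuousMap.sum_apply]
    refine Finset.sum_congr rfl fun g _ => ?_
    rw [act_mul, map_smul]
    rfl

lemma inner_mul_phase (v : ℂ) (s : ℝ) (α : 𝕋) : inner ℝ v (s * phase α) = s * comp v α := by
  rw [Complex.inner, comp, ← Complex.re_ofReal_mul]
  congr 1
  ring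

/-- The characteristic function of the walk, on the circle of radius `s`. -/
theorem charFun_walkLaw (hfin : μ.support.Finite) (n : ℕ) (s : ℝ) (α : 𝕋) :
    charFun (walkLaw μ n).toMeasure (s * phase α) =
      (avg s hfin.toFinset (fun g => (μ g).toReal) ^ n) 1 α := by
  have hb : ∀ x : ℂ, ‖Complex.exp ((inner ℝ x (s * phase α) : ℝ) * Complex.I)‖ ≤ 1 := fun x =>
    (Complex.norm_exp_ofReal_mul_I _).le
  rw [charFun_apply, PMF.integral_eq_tsum]
  · have h1 : ∑' x, ((walkLaw μ n) x).toReal •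
        Complex.exp ((inner ℝ x (s * phase α) : ℝ) * Complex.I) =
        expect (walkLaw μ n) fun x => Complex.exp ((inner ℝ x (s * phase α) : ℝ) * Complex.I) :=
      tsum_congr fun x => Complex.real_smul
    rw [h1, walkLaw, expect_map _ _ hb, ← expect_productLaw_act]
    congr 1
    ext h
    rw [act_apply, inner_mul_phase]
    simp
  · refine Integrable.of_bound (C := 1) ?_ (ae_of_all _ hb)
    exact Continuous.aestronglyMeasurable (by fun_prop)

lemma isGenericWalk_of_pmf (hfin : μ.support.Finite) (hsymm : IsSymmetric μ) (hdrift : drift μ = 0)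
    {g₀ : rigidMotions} (hg₀ : g₀ ∈ μ.support) (hq : ∃ q : ℚ, Real.cos (angle g₀) = q)
    (hhalf : ∀ k : ℤ, Real.cos (angle g₀) ≠ k / 2) (hne : ∃ g ∈ μ.support, trans g ≠ 0) :
    IsGenericWalk hfin.toFinset (fun g => (μ g).toReal) g₀ := by
  obtain ⟨q, hq⟩ := hq
  obtain ⟨A, B, hB, hAB, hrel, him⟩ := exists_quadratic_relation hq hhalf
  have hmem : ∀ g, g ∈ hfin.toFinset ↔ g ∈ μ.support := fun g => hfin.mem_toFinset
  have hzero : ∀ g, g ∉ hfin.toFinset → μ g = 0 := fun g hg => by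
    rw [hmem, PMF.mem_support_iff, not_not] at hg
    exact hg
  refine ⟨fun g hg => ?_, ?_, fun g hg => ?_, ?_, (hmem _).mpr hg₀, ⟨A, B, hB, hAB, hrel⟩, him, ?_⟩
  · exact ENNReal.toReal_pos ((PMF.mem_support_iff _ _).mp ((hmem g).mp hg)) (μ.apply_ne_top g)
  · have htsum : ∑' g, μ g = ∑ g ∈ hfin.toFinset, μ g := tsum_eq_sum hzero
    rw [← ENNReal.toReal_sum fun g _ => μ.apply_ne_top g, ← htsum, μ.tsum_coe]
    rfl
  -- Symmetry of `μ` enters here, as closure of the support under inverses.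
  · rw [hmem] at hg ⊢
    rw [← hsymm, PMF.support_map]
    exact ⟨g, hg, rfl⟩
  · rw [← hdrift, drift, tsum_eq_sum fun g hg => by rw [hzero g hg]; simp]
    exact Finset.sum_congr rfl fun g _ => Complex.real_smul.symm
  · obtain ⟨g, hg, h⟩ := hne
    exact ⟨g, (hmem g).mpr hg, h⟩

lemma sigma_sq_eq (hfin : μ.support.Finite) :
    sigma μ ^ 2 = variance hfin.toFinset fun g => (μ g).toReal := by
  have hzero : ∀ g, g ∉ hfin.toFinset → μ g = 0 := fun g hg => by
    rw [hfin.mem_toFinset, PMF.mem_support_iff, not_not] at hg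
    exact hg
  rw [sigma, tsum_eq_sum fun g hg => by rw [hzero g hg]; simp, Real.sq_sqrt]
  · rfl
  · exact mul_nonneg (by norm_num)
      (Finset.sum_nonneg fun g _ => mul_nonneg ENNReal.toReal_nonneg (sq_nonneg _))

end Expectation

/-! ### Walks whose steps all fix the origin -/

section Degenerate

variable {μ : PMF rigidMotions}

lemma trans_eq_zero_of_mem_support_productLaw (h : ∀ g ∈ μ.support, trans g = 0) (n : ℕ) :
    ∀ g ∈ (productLaw μ n).support, trans g = 0 := by
  induction n with
  | zero =>
    intro g hg
    rw [productLaw, PMF.support_pure, Set.mem_singleton_iff] at hg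
    rw [hg, trans_one]
  | succ n ih =>
    intro g hg
    rw [productLaw, PMF.mem_support_bind_iff] at hg
    obtain ⟨a, ha, hg⟩ := hg
    rw [PMF.support_map] at hg
    obtain ⟨b, hb, rfl⟩ := hg
    rw [trans_mul, h b hb, ih a ha, mul_zero, add_zero]

lemma walkLaw_eq_pure_zero (h : ∀ g ∈ μ.support, trans g = 0) (n : ℕ) :
    walkLaw μ n = PMF.pure 0 := by
  rw [walkLaw, PMF.map, ← PMF.bind_const (productLaw μ n) (PMF.pure 0)]
  ext x
  rw [PMF.bind_apply, PMF.bind_apply]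
  refine tsum_congr fun g => ?_
  by_cases hg : g ∈ (productLaw μ n).support
  · rw [Function.comp_apply, trans_eq_zero_of_mem_support_productLaw h n g hg]
  · rw [PMF.mem_support_iff, not_not] at hg
    rw [hg, zero_mul, zero_mul]

lemma sigma_eq_zero (h : ∀ g ∈ μ.support, trans g = 0) : sigma μ = 0 := by
  have : ∀ g, (μ g).toReal * ‖trans g‖ ^ 2 = 0 := by
    intro g
    by_cases hg : g ∈ μ.support
    · rw [h g hg]; simp
    · rw [PMF.mem_support_iff, not_not] at hg
      simp [hg]
  simp [sigma, this]

end Degenerate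

/-! ### Comparing masses of balls through smoothed densities -/

section Smoothing

/-- The density at `w` of the law `ν` smoothed by the kernel `κ`. -/
def smoothed (κ : ℂ → ℝ) (ν : Measure ℂ) (w : ℂ) : ℝ := ∫ y, κ (y - w) ∂ν

variable {κ : ℂ → ℝ} {δ : ℝ}

lemma integrable_prod_kernel (hκ : Continuous κ) {M : ℝ} (hM : ∀ x, ‖κ x‖ ≤ M)
    (ν : Measure ℂ) [IsFiniteMeasure ν] (x₀ : ℂ) (r : ℝ) :
    Integrable (fun p : ℂ × ℂ => κ (p.2 - p.1)) ((volume.restrict (Metric.ball x₀ r)).prod ν) := by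
  have : IsFiniteMeasure (volume.restrict (Metric.ball x₀ r)) :=
    ⟨by rw [Measure.restrict_apply_univ]; exact measure_ball_lt_top⟩
  exact Integrable.of_bound (C := M) (Continuous.aestronglyMeasurable (by fun_prop))
    (ae_of_all _ fun p => hM _)

lemma integrableOn_smoothed (hκ : Continuous κ) {M : ℝ} (hM : ∀ x, ‖κ x‖ ≤ M)
    (ν : Measure ℂ) [IsFiniteMeasure ν] (x₀ : ℂ) (r : ℝ) :
    IntegrableOn (smoothed κ ν) (Metric.ball x₀ r) :=
  (integrable_prod_kernel hκ hM ν x₀ r).integral_prod_left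

lemma setIntegral_smoothed (hκ : Continuous κ) {M : ℝ} (hM : ∀ x, ‖κ x‖ ≤ M)
    (ν : Measure ℂ) [IsFiniteMeasure ν] (x₀ : ℂ) (r : ℝ) :
    ∫ w in Metric.ball x₀ r, smoothed κ ν w = ∫ y, (∫ w in Metric.ball x₀ r, κ (y - w)) ∂ν :=
  integral_integral_swap (integrable_prod_kernel hκ hM ν x₀ r)

lemma integrable_setIntegral_kernel (hκ : Continuous κ) {M : ℝ} (hM : ∀ x, ‖κ x‖ ≤ M)
    (ν : Measure ℂ) [IsFiniteMeasure ν] (x₀ : ℂ) (r : ℝ) :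
    Integrable (fun y => ∫ w in Metric.ball x₀ r, κ (y - w)) ν :=
  (integrable_prod_kernel hκ hM ν x₀ r).integral_prod_right

/-- A unit mass at a point of the smaller ball, spread over distance less than `δ`, stays in the
larger ball. -/
lemma real_ball_le_setIntegral_smoothed (hκ : Continuous κ) {M : ℝ} (hM : ∀ x, ‖κ x‖ ≤ M)
    (hnn : ∀ x, 0 ≤ κ x) (hsupp : ∀ x, δ ≤ ‖x‖ → κ x = 0) (hint : ∫ x, κ x = 1)
    (ν : Measure ℂ) [IsFiniteMeasure ν] (x₀ : ℂ) (r : ℝ) :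
    ν.real (Metric.ball x₀ r) ≤ ∫ w in Metric.ball x₀ (r + δ), smoothed κ ν w := by
  rw [setIntegral_smoothed hκ hM, ← integral_indicator_one Metric.isOpen_ball.measurableSet]
  apply integral_mono
  · exact (integrable_indicator_iff Metric.isOpen_ball.measurableSet).mpr
      (integrable_const (1 : ℝ)).integrableOn
  · exact integrable_setIntegral_kernel hκ hM ν x₀ (r + δ)
  · intro y
    beta_reduce
    by_cases hy : y ∈ Metric.ball x₀ r
    · rw [Set.indicator_of_mem hy, setIntegral_eq_integral_of_forall_compl_eq_zero,
        integral_sub_left_eq_self κ volume y, hint]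
      · rfl
      · intro w hw
        apply hsupp
        by_contra hlt
        rw [not_le] at hlt
        apply hw
        rw [Metric.mem_ball] at hy ⊢
        calc dist w x₀ ≤ dist w y + dist y x₀ := dist_triangle _ _ _
          _ < r + δ := by rw [dist_comm w y, dist_eq_norm]; linarith
    · rw [Set.indicator_of_notMem hy]
      exact integral_nonneg fun w => hnn _

lemma setIntegral_smoothed_le_real_ball (hκ : Continuous κ) {M : ℝ} (hM : ∀ x, ‖κ x‖ ≤ M)
    (hnn : ∀ x, 0 ≤ κ x) (hsupp : ∀ x, δ ≤ ‖x‖ → κ x = 0) (hint : ∫ x, κ x = 1)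
    (ν : Measure ℂ) [IsFiniteMeasure ν] (x₀ : ℂ) (r : ℝ) :
    ∫ w in Metric.ball x₀ (r - δ), smoothed κ ν w ≤ ν.real (Metric.ball x₀ r) := by
  rw [setIntegral_smoothed hκ hM, ← integral_indicator_one Metric.isOpen_ball.measurableSet]
  apply integral_mono
  · exact integrable_setIntegral_kernel hκ hM ν x₀ (r - δ)
  · exact (integrable_indicator_iff Metric.isOpen_ball.measurableSet).mpr
      (integrable_const (1 : ℝ)).integrableOn
  · intro y
    have hκi : Integrable κ := by
      by_contra h
      rw [integral_undef h] at hint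
      exact zero_ne_one hint
    by_cases hy : y ∈ Metric.ball x₀ r
    · rw [Set.indicator_of_mem hy]
      refine (setIntegral_le_integral (hκi.comp_sub_left y) (ae_of_all _ fun w => hnn _)).trans ?_
      rw [integral_sub_left_eq_self κ volume y, hint]
      rfl
    · rw [Set.indicator_of_notMem hy]
      apply le_of_eq
      refine setIntegral_eq_zero_of_forall_eq_zero fun w hw => hsupp _ ?_
      by_contra hlt
      rw [not_le] at hlt
      apply hy
      rw [Metric.mem_ball] at hw ⊢
      calc dist y x₀ ≤ dist y w + dist w x₀ := dist_triangle _ _ _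
        _ < r := by rw [dist_eq_norm]; linarith

lemma volume_real_ball (x₀ : ℂ) {r : ℝ} (hr : 0 ≤ r) :
    (volume : Measure ℂ).real (Metric.ball x₀ r) = Real.pi * r ^ 2 := by
  rw [Measure.real, Complex.volume_ball]
  simp [hr, mul_comm]

/-- The annulus has area `π (r + δ)² - π (r - δ)² = 4 π r δ`. -/
lemma setIntegral_smoothed_enlarge_le (hκ : Continuous κ) {M : ℝ} (hM : ∀ x, ‖κ x‖ ≤ M)
    (ν : Measure ℂ) [IsFiniteMeasure ν] {b : ℝ} (hb : ∀ w, smoothed κ ν w ≤ b) (x₀ : ℂ) {r : ℝ}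
    (hδ : 0 ≤ δ) (hδr : δ ≤ r) :
    ∫ w in Metric.ball x₀ (r + δ), smoothed κ ν w ≤
      (∫ w in Metric.ball x₀ (r - δ), smoothed κ ν w) + b * (4 * Real.pi * r * δ) := by
  have hsub : Metric.ball x₀ (r - δ) ⊆ Metric.ball x₀ (r + δ) :=
    Metric.ball_subset_ball (by linarith)
  have hi := integrableOn_smoothed hκ hM ν x₀ (r + δ)
  have h1 := integral_inter_add_sdiff (f := smoothed κ ν) (μ := volume)
    (s := Metric.ball x₀ (r + δ)) (t := Metric.ball x₀ (r - δ)) Metric.isOpen_ball.measurableSet hi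
  rw [Set.inter_eq_self_of_subset_right hsub] at h1
  have hfin : volume (Metric.ball x₀ (r + δ) \ Metric.ball x₀ (r - δ)) ≠ ⊤ :=
    ((measure_mono Set.sdiff_subset).trans_lt measure_ball_lt_top).ne
  have h2 : ∫ w in Metric.ball x₀ (r + δ) \ Metric.ball x₀ (r - δ), smoothed κ ν w ≤
      ∫ _ in Metric.ball x₀ (r + δ) \ Metric.ball x₀ (r - δ), b :=
    integral_mono (hi.mono_set Set.sdiff_subset) (integrableOn_const hfin) hb
  rw [setIntegral_const, measureReal_sdiff hsub Metric.isOpen_ball.measurableSet,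
    volume_real_ball x₀ (by linarith), volume_real_ball x₀ (by linarith), smul_eq_mul] at h2
  nlinarith

/-- Two laws whose smoothed densities are close give nearly the same mass to balls. -/
theorem abs_real_ball_sub_le (hκ : Continuous κ) {M : ℝ} (hM : ∀ x, ‖κ x‖ ≤ M)
    (hnn : ∀ x, 0 ≤ κ x) (hsupp : ∀ x, δ ≤ ‖x‖ → κ x = 0) (hint : ∫ x, κ x = 1)
    (ν₁ ν₂ : Measure ℂ) [IsFiniteMeasure ν₁] [IsFiniteMeasure ν₂] {a b : ℝ}
    (ha : ∀ w, |smoothed κ ν₁ w - smoothed κ ν₂ w| ≤ a) (hb : ∀ w, smoothed κ ν₂ w ≤ b)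
    (x₀ : ℂ) {r : ℝ} (hδ : 0 ≤ δ) (hδr : δ ≤ r) :
    |ν₁.real (Metric.ball x₀ r) - ν₂.real (Metric.ball x₀ r)| ≤
      a * (4 * Real.pi * r ^ 2) + b * (4 * Real.pi * r * δ) := by
  have ha0 : 0 ≤ a := (abs_nonneg _).trans (ha 0)
  have hvol : ∀ t, 0 ≤ t → t ≤ 2 * r → ∫ _ in Metric.ball x₀ t, a ≤ a * (4 * Real.pi * r ^ 2) := by
    intro t ht htr
    rw [setIntegral_const, volume_real_ball x₀ ht, smul_eq_mul]
    have : t ^ 2 ≤ (2 * r) ^ 2 := pow_le_pow_left₀ ht htr 2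
    nlinarith [mul_nonneg Real.pi_pos.le ha0]
  have hconst : ∀ t, IntegrableOn (fun _ : ℂ => a) (Metric.ball x₀ t) := fun t =>
    integrableOn_const measure_ball_lt_top.ne
  have h1 := real_ball_le_setIntegral_smoothed hκ hM hnn hsupp hint ν₁ x₀ r
  have h2 := setIntegral_smoothed_le_real_ball hκ hM hnn hsupp hint ν₁ x₀ r
  have h3 := real_ball_le_setIntegral_smoothed hκ hM hnn hsupp hint ν₂ x₀ r
  have h4 := setIntegral_smoothed_le_real_ball hκ hM hnn hsupp hint ν₂ x₀ r
  have h5 := setIntegral_smoothed_enlarge_le hκ hM ν₂ hb x₀ hδ hδr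
  have h6 : ∫ w in Metric.ball x₀ (r + δ), smoothed κ ν₁ w ≤
      (∫ w in Metric.ball x₀ (r + δ), smoothed κ ν₂ w) + ∫ _ in Metric.ball x₀ (r + δ), a := by
    rw [← integral_add (integrableOn_smoothed hκ hM ν₂ x₀ _) (hconst _)]
    exact integral_mono (integrableOn_smoothed hκ hM ν₁ x₀ _)
      ((integrableOn_smoothed hκ hM ν₂ x₀ _).add (hconst _))
      fun w => by have := (abs_le.mp (ha w)).2; simp only; linarith
  have h7 : ∫ w in Metric.ball x₀ (r - δ), smoothed κ ν₂ w ≤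
      (∫ w in Metric.ball x₀ (r - δ), smoothed κ ν₁ w) + ∫ _ in Metric.ball x₀ (r - δ), a := by
    rw [← integral_add (integrableOn_smoothed hκ hM ν₁ x₀ _) (hconst _)]
    exact integral_mono (integrableOn_smoothed hκ hM ν₂ x₀ _)
      ((integrableOn_smoothed hκ hM ν₁ x₀ _).add (hconst _))
      fun w => by have := (abs_le.mp (ha w)).1; simp only; linarith
  have h8 := hvol (r + δ) (by linarith) (by linarith)
  have h9 := hvol (r - δ) (by linarith) (by linarith)
  rw [abs_le]
  constructor <;> linarith

end Smoothing

/-! ### The smoothing kernel -/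

section Kernel

open scoped FourierTransform SchwartzMap ContDiff

/-- A smooth probability density on the unit disc whose Fourier transform decays like `‖η‖⁻⁴`. -/
theorem exists_kernel : ∃ (κ : ℂ → ℝ) (k : ℂ → ℂ) (D : ℝ), Continuous κ ∧ (∀ x, 0 ≤ κ x) ∧
    (∀ x, 1 ≤ ‖x‖ → κ x = 0) ∧ ∫ x, κ x = 1 ∧ (∃ M, ∀ x, ‖κ x‖ ≤ M) ∧ Continuous k ∧
    Integrable k ∧ 0 < D ∧ (∀ η, ‖k η‖ ≤ D) ∧ (∀ η, ‖η‖ ^ 4 * ‖k η‖ ≤ D) ∧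
    ∀ x, (κ x : ℂ) = ∫ η, Complex.exp ((inner ℝ x η : ℝ) * Complex.I) * k η := by
  let b : ContDiffBump (0 : ℂ) := ⟨1 / 2, 1, by norm_num, by norm_num⟩
  set κ : ℂ → ℝ := b.normed volume with hκ
  have hcont : Continuous κ := b.continuous_normed
  have hcs : HasCompactSupport κ := b.hasCompactSupport_normed
  have hcsC : HasCompactSupport fun x => (κ x : ℂ) := hcs.comp_left (g := fun t : ℝ => (t : ℂ)) rfl
  have hsm : ContDiff ℝ ∞ fun x => (κ x : ℂ) :=
    Complex.ofRealCLM.contDiff.comp b.contDiff_normed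
  set f : 𝓢(ℂ, ℂ) := hcsC.toSchwartzMap hsm with hf
  have hfκ : ∀ x, f x = κ x := fun x => rfl
  set F : 𝓢(ℂ, ℂ) := 𝓕 f with hF
  have h2pi : (0 : ℝ) < 2 * Real.pi := Real.two_pi_pos
  -- Rescaling by `2π` passes from the convention `e^{2πi⟨x,ξ⟩}` to that of characteristic
  -- functions; the square is the Jacobian in the plane.
  set k : ℂ → ℂ := fun η => ((2 * Real.pi : ℝ) : ℂ)⁻¹ ^ 2 * F ((2 * Real.pi)⁻¹ • η) with hk
  obtain ⟨D₀, hD₀⟩ := F.decay 0 0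
  obtain ⟨D₄, hD₄⟩ := F.decay 4 0
  simp only [norm_iteratedFDeriv_zero, pow_zero, one_mul] at hD₀ hD₄
  have hknorm : ∀ η, ‖k η‖ = (2 * Real.pi)⁻¹ ^ 2 * ‖F ((2 * Real.pi)⁻¹ • η)‖ := fun η => by
    simp only [hk]
    rw [norm_mul, norm_pow, norm_inv, Complex.norm_real, Real.norm_of_nonneg h2pi.le]
  obtain ⟨M, hM⟩ := hcs.exists_bound_of_continuous hcont
  refine ⟨κ, k, (2 * Real.pi)⁻¹ ^ 2 * D₀ + (2 * Real.pi) ^ 2 * D₄, hcont, b.nonneg_normed, ?_,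
    b.integral_normed, ⟨M, hM⟩, ?_, ?_, ?_, ?_, ?_, ?_⟩
  · intro x hx
    have : x ∉ Function.support κ := by
      rw [hκ, b.support_normed_eq, mem_ball_zero_iff, not_lt]
      exact hx
    simpa using this
  · exact continuous_const.mul (F.continuous.comp (by fun_prop))
  · exact ((integrable_comp_smul_iff volume F (inv_ne_zero h2pi.ne')).mpr F.integrable).const_mul _
  · have := hD₀.1
    have := hD₄.1
    positivity
  · intro η
    rw [hknorm]
    have := mul_le_mul_of_nonneg_left (hD₀.2 ((2 * Real.pi)⁻¹ • η))
      (show 0 ≤ (2 * Real.pi)⁻¹ ^ 2 by positivity)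
    have h4 : 0 ≤ (2 * Real.pi) ^ 2 * D₄ := by have := hD₄.1; positivity
    linarith
  · intro η
    rw [hknorm]
    have h1 := hD₄.2 ((2 * Real.pi)⁻¹ • η)
    rw [norm_smul, Real.norm_of_nonneg (inv_nonneg.mpr h2pi.le)] at h1
    have h2 : ‖η‖ ^ 4 * ((2 * Real.pi)⁻¹ ^ 2 * ‖F ((2 * Real.pi)⁻¹ • η)‖) =
        (2 * Real.pi) ^ 2 * (((2 * Real.pi)⁻¹ * ‖η‖) ^ 4 * ‖F ((2 * Real.pi)⁻¹ • η)‖) := by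
      field_simp
    rw [h2]
    have h3 : 0 ≤ (2 * Real.pi)⁻¹ ^ 2 * D₀ := by have := hD₀.1; positivity
    have h4 := mul_le_mul_of_nonneg_left h1 (show 0 ≤ (2 * Real.pi) ^ 2 by positivity)
    linarith
  · intro x
    have hinv : 𝓕⁻ F = f := FourierTransform.fourierInv_fourier_eq f
    have h1 : f x = ∫ ξ, Complex.exp ((2 * Real.pi * inner ℝ ξ x : ℝ) * Complex.I) • F ξ := by
      conv_lhs => rw [← hinv]
      rw [SchwartzMap.fourierInv_coe, Real.fourierInv_eq']
    rw [← hfκ, h1]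
    have h2 := Measure.integral_comp_smul (volume : Measure ℂ) (fun ξ : ℂ =>
      Complex.exp ((2 * Real.pi * inner ℝ ξ x : ℝ) * Complex.I) • F ξ) (2 * Real.pi)⁻¹
    rw [Complex.finrank_real_complex, abs_of_pos (by positivity), inv_pow, inv_inv] at h2
    have h3 : ∀ η, Complex.exp ((inner ℝ x η : ℝ) * Complex.I) * k η = (((2 * Real.pi) ^ 2)⁻¹ : ℝ) •
        (Complex.exp ((2 * Real.pi * inner ℝ ((2 * Real.pi)⁻¹ • η) x : ℝ) * Complex.I) •
          F ((2 * Real.pi)⁻¹ • η)) := by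
      intro η
      rw [real_inner_smul_left, real_inner_comm, mul_inv_cancel_left₀ h2pi.ne']
      simp only [hk, Complex.real_smul, smul_eq_mul]
      push_cast
      ring
    simp_rw [h3]
    rw [integral_smul, h2, smul_smul, inv_mul_cancel₀ (by positivity), one_smul]

end Kernel

/-! ### Fourier inversion and polar coordinates -/

section FourierSide

local notation "𝕋" => AddCircle (2 * Real.pi)

variable {κ : ℂ → ℝ} {k : ℂ → ℂ}

lemma smoothed_eq_integral_charFun (hki : Integrable k)
    (hrep : ∀ x, (κ x : ℂ) = ∫ η, Complex.exp ((inner ℝ x η : ℝ) * Complex.I) * k η)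
    (ν : Measure ℂ) [IsFiniteMeasure ν] (w : ℂ) :
    (smoothed κ ν w : ℂ) =
      ∫ η, Complex.exp ((-inner ℝ w η : ℝ) * Complex.I) * k η * charFun ν η := by
  have hint : Integrable (fun p : ℂ × ℂ =>
      Complex.exp ((inner ℝ (p.1 - w) p.2 : ℝ) * Complex.I) * k p.2) (ν.prod volume) := by
    refine (hki.comp_snd ν).bdd_mul (c := 1) (Continuous.aestronglyMeasurable (by fun_prop))
      (ae_of_all _ fun p => (Complex.norm_exp_ofReal_mul_I _).le)
  rw [smoothed, ← integral_complex_ofReal]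
  simp_rw [hrep]
  rw [integral_integral_swap hint]
  refine integral_congr_ae (ae_of_all _ fun η => ?_)
  simp only [charFun_apply]
  rw [← integral_const_mul]
  refine integral_congr_ae (ae_of_all _ fun y => ?_)
  simp only
  rw [inner_sub_left, mul_right_comm, ← Complex.exp_add]
  congr 2
  push_cast
  ring

lemma integrable_kernel_mul_charFun (hki : Integrable k) (ν : Measure ℂ)
    [IsProbabilityMeasure ν] (w : ℂ) :
    Integrable fun η => Complex.exp ((-inner ℝ w η : ℝ) * Complex.I) * k η * charFun ν η := by
  refine Integrable.mul_bdd (c := 1) (hki.bdd_mul (c := 1)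
    (Continuous.aestronglyMeasurable (by fun_prop))
    (ae_of_all _ fun p => (Complex.norm_exp_ofReal_mul_I _).le))
    continuous_charFun.aestronglyMeasurable (ae_of_all _ fun η => norm_charFun_le_one η)

lemma abs_smoothed_sub_le (hki : Integrable k)
    (hrep : ∀ x, (κ x : ℂ) = ∫ η, Complex.exp ((inner ℝ x η : ℝ) * Complex.I) * k η)
    (ν₁ ν₂ : Measure ℂ) [IsProbabilityMeasure ν₁] [IsProbabilityMeasure ν₂] (w : ℂ) :
    |smoothed κ ν₁ w - smoothed κ ν₂ w| ≤ ∫ η, ‖k η‖ * ‖charFun ν₁ η - charFun ν₂ η‖ := by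
  have h1 : ((smoothed κ ν₁ w - smoothed κ ν₂ w : ℝ) : ℂ) =
      ∫ η, Complex.exp ((-inner ℝ w η : ℝ) * Complex.I) * k η *
        (charFun ν₁ η - charFun ν₂ η) := by
    push_cast
    rw [smoothed_eq_integral_charFun hki hrep, smoothed_eq_integral_charFun hki hrep,
      ← integral_sub (integrable_kernel_mul_charFun hki ν₁ w)
        (integrable_kernel_mul_charFun hki ν₂ w)]
    simp_rw [mul_sub]
    push_cast
    rfl
  rw [← Real.norm_eq_abs, ← Complex.norm_real, h1]
  refine (norm_integral_le_integral_norm _).trans (le_of_eq ?_)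
  refine integral_congr_ae (ae_of_all _ fun η => ?_)
  simp only [norm_mul, Complex.norm_exp_ofReal_mul_I, one_mul]

lemma smoothed_le (hki : Integrable k)
    (hrep : ∀ x, (κ x : ℂ) = ∫ η, Complex.exp ((inner ℝ x η : ℝ) * Complex.I) * k η)
    (ν : Measure ℂ) [IsProbabilityMeasure ν] (w : ℂ) :
    smoothed κ ν w ≤ ∫ η, ‖k η‖ * ‖charFun ν η‖ := by
  refine (le_abs_self _).trans ?_
  rw [← Real.norm_eq_abs, ← Complex.norm_real, smoothed_eq_integral_charFun hki hrep]
  refine (norm_integral_le_integral_norm _).trans (le_of_eq ?_)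
  refine integral_congr_ae (ae_of_all _ fun η => ?_)
  simp only [norm_mul, Complex.norm_exp_ofReal_mul_I, one_mul]

lemma scaled_kernel_representation
    (hrep : ∀ x, (κ x : ℂ) = ∫ η, Complex.exp ((inner ℝ x η : ℝ) * Complex.I) * k η)
    {δ : ℝ} (hδ : 0 < δ) (x : ℂ) : (((δ ^ 2)⁻¹ * κ (δ⁻¹ • x) : ℝ) : ℂ) =
      ∫ η, Complex.exp ((inner ℝ x η : ℝ) * Complex.I) * k (δ • η) := by
  have h := Measure.integral_comp_smul (volume : Measure ℂ) (fun ξ : ℂ =>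
      Complex.exp ((inner ℝ (δ⁻¹ • x) ξ : ℝ) * Complex.I) * k ξ) δ
  rw [Complex.finrank_real_complex, abs_of_pos (by positivity), ← hrep] at h
  rw [Complex.ofReal_mul, ← Complex.real_smul, ← h]
  refine integral_congr_ae (ae_of_all _ fun η => ?_)
  simp only
  rw [real_inner_smul_left, real_inner_smul_right, inv_mul_cancel_left₀ hδ.ne']

lemma integral_scaled_kernel (hint : ∫ x, κ x = 1) {δ : ℝ} (hδ : 0 < δ) :
    ∫ x : ℂ, (δ ^ 2)⁻¹ * κ (δ⁻¹ • x) = 1 := by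
  rw [integral_const_mul, Measure.integral_comp_smul, Complex.finrank_real_complex, hint,
    abs_of_pos (by positivity), smul_eq_mul, mul_one, inv_pow, inv_inv,
    inv_mul_cancel₀ (by positivity)]

/-- Cauchy–Schwarz on a circle of mass `2π ≤ 9`, obtained from the nonnegativity of the variance of
`‖f‖`. -/
lemma integral_norm_le_l2 (f : C(𝕋, ℂ)) : ∫ α, ‖f α‖ ≤ 3 * l2 f := by
  set m : ℝ := (∫ α, ‖f α‖) / (2 * Real.pi) with hm
  have hpi := Real.two_pi_pos
  have h1 : 0 ≤ ∫ α, (‖f α‖ - m) ^ 2 := integral_nonneg fun α => sq_nonneg _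
  have h2 : ∫ α, (‖f α‖ - m) ^ 2 =
      (∫ α, ‖f α‖ ^ 2) - 2 * m * (∫ α, ‖f α‖) + 2 * Real.pi * m ^ 2 := by
    have e : ∀ α, (‖f α‖ - m) ^ 2 = ‖f α‖ ^ 2 - 2 * m * ‖f α‖ + m ^ 2 := fun α => by ring
    simp_rw [e]
    rw [integral_add (integrable_circle (by fun_prop)) (integrable_circle (by fun_prop)),
      integral_sub (integrable_circle (by fun_prop)) (integrable_circle (by fun_prop)),
      integral_const_mul, integral_const]
    simp [Measure.real, AddCircle.measure_univ, Real.pi_pos.le]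
  rw [h2, ← l2_sq] at h1
  have h3 : (∫ α, ‖f α‖) = m * (2 * Real.pi) := by rw [hm]; field_simp
  rw [h3] at h1 ⊢
  have h4 : (m * (2 * Real.pi)) ^ 2 ≤ (3 * l2 f) ^ 2 := by
    have h5 : m ^ 2 * (2 * Real.pi) ≤ l2 f ^ 2 := by nlinarith
    have h6 : 2 * Real.pi ≤ 9 := by linarith [Real.pi_lt_d2]
    nlinarith [sq_nonneg (l2 f)]
  exact le_of_sq_le_sq h4 (mul_nonneg (by norm_num) (l2_nonneg f))

lemma polarCoord_symm_eq_phase (s t : ℝ) :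
    Complex.polarCoord.symm (s, t) = s * phase (t : 𝕋) := by
  rw [Complex.polarCoord_symm_apply, phase_coe, Complex.exp_mul_I]
  push_cast
  rfl

/-- Integration over the plane by circles about the origin. -/
lemma integral_le_of_circle_integral_le {f : ℂ → ℝ} (hf : Continuous f) (hnn : ∀ x, 0 ≤ f x)
    {G : ℝ → ℝ} (hG : IntegrableOn G (Set.Ioi 0)) (hG0 : ∀ s, 0 < s → 0 ≤ G s)
    (h : ∀ s : ℝ, 0 < s → s * ∫ α : 𝕋, f (s * phase α) ≤ G s) :
    ∫ x, f x ≤ ∫ s in Set.Ioi 0, G s := by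
  have hGnn : 0 ≤ᵐ[volume.restrict (Set.Ioi 0)] G :=
    (ae_restrict_iff' measurableSet_Ioi).mpr (ae_of_all _ hG0)
  rw [integral_eq_lintegral_of_nonneg_ae (ae_of_all _ hnn) hf.aestronglyMeasurable]
  refine ENNReal.toReal_le_of_le_ofReal (integral_nonneg_of_ae hGnn) ?_
  rw [ofReal_integral_eq_lintegral_ofReal hG hGnn, ← Complex.lintegral_comp_polarCoord_symm,
    polarCoord_target, Measure.volume_eq_prod, ← Measure.prod_restrict]
  have hmeas : Measurable fun p : ℝ × ℝ =>
      ENNReal.ofReal p.1 • ENNReal.ofReal (f (Complex.polarCoord.symm p)) := by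
    simp_rw [Complex.polarCoord_symm_apply]
    have : Continuous fun p : ℝ × ℝ =>
        f (p.1 * ((Real.cos p.2 : ℂ) + (Real.sin p.2 : ℂ) * Complex.I)) := by fun_prop
    exact (measurable_fst.ennreal_ofReal).smul this.measurable.ennreal_ofReal
  rw [lintegral_prod _ hmeas.aemeasurable]
  refine setLIntegral_mono' measurableSet_Ioi fun s hs => ?_
  have hs0 : (0 : ℝ) < s := hs
  have hcont : Continuous fun α : 𝕋 => f (s * phase α) := by fun_prop
  have h1 : ∫⁻ t in Set.Ioo (-Real.pi) Real.pi, ENNReal.ofReal (f (s * phase (t : 𝕋))) =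
      ENNReal.ofReal (∫ α : 𝕋, f (s * phase α)) := by
    rw [ofReal_integral_eq_lintegral_ofReal (integrable_circle hcont) (ae_of_all _ fun α => hnn _),
      ← AddCircle.lintegral_preimage (2 * Real.pi) (-Real.pi),
      show -Real.pi + 2 * Real.pi = Real.pi by ring]
    exact setLIntegral_congr Ioo_ae_eq_Ioc
  simp_rw [polarCoord_symm_eq_phase, smul_eq_mul]
  rw [lintegral_const_mul', h1, ← ENNReal.ofReal_mul hs0.le]
  · exact ENNReal.ofReal_le_ofReal (h s hs0)
  · exact ENNReal.ofReal_ne_top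

end FourierSide

/-! ### Radial integrals over the frequency ranges -/

section RadialIntegrals

local notation "𝕋" => AddCircle (2 * Real.pi)

lemma integrableOn_pow_mul_exp (m : ℕ) {b : ℝ} (hb : 0 < b) :
    IntegrableOn (fun s : ℝ => s ^ m * Real.exp (-(b * s ^ 2))) (Set.Ioi 0) := by
  have h := integrableOn_rpow_mul_exp_neg_mul_sq hb (s := (m : ℝ))
    (by linarith [m.cast_nonneg (α := ℝ)])
  simpa [Real.rpow_natCast, neg_mul] using h

lemma integral_pow_mul_exp (m : ℕ) {b : ℝ} (hb : 0 < b) :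
    ∫ s in Set.Ioi (0 : ℝ), s ^ m * Real.exp (-(b * s ^ 2)) =
      b ^ (-((m : ℝ) + 1) / 2) * (1 / 2) * Real.Gamma (((m : ℝ) + 1) / 2) := by
  have h := integral_rpow_mul_exp_neg_mul_rpow (p := 2) (q := (m : ℝ)) two_pos
    (by linarith [m.cast_nonneg (α := ℝ)]) hb
  simpa [Real.rpow_natCast, neg_mul] using h

/-- The integrand is the low-frequency bound times the polar Jacobian `s`. By scaling, the two terms
are of order `n · n^{-5/2}` and `n⁻²`. -/
lemma exists_lowFrequency_integral_le {c : ℝ} (hc : 0 < c) : ∃ C : ℝ, 0 < C ∧ ∀ n : ℕ, 1 ≤ n →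
    IntegrableOn (fun s : ℝ => (n * s ^ 4 + s ^ 3) * Real.exp (-(c * n * s ^ 2))) (Set.Ioi 0) ∧
    ∫ s in Set.Ioi (0 : ℝ), (n * s ^ 4 + s ^ 3) * Real.exp (-(c * n * s ^ 2)) ≤
      C * (n : ℝ) ^ (-(3 / 2) : ℝ) := by
  have hg5 : 0 < Real.Gamma (((4 : ℕ) + 1 : ℝ) / 2) := Real.Gamma_pos_of_pos (by positivity)
  have hg4 : 0 < Real.Gamma (((3 : ℕ) + 1 : ℝ) / 2) := Real.Gamma_pos_of_pos (by positivity)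
  set A := c ^ (-((4 : ℕ) + 1 : ℝ) / 2) * (1 / 2) * Real.Gamma (((4 : ℕ) + 1 : ℝ) / 2) with hA
  set B := c ^ (-((3 : ℕ) + 1 : ℝ) / 2) * (1 / 2) * Real.Gamma (((3 : ℕ) + 1 : ℝ) / 2) with hB
  have hApos : 0 < A := by positivity
  have hBpos : 0 < B := by positivity
  refine ⟨A + B, by positivity, fun n hn => ?_⟩
  have hn0 : (0 : ℝ) < n := by exact_mod_cast hn
  have hn1 : (1 : ℝ) ≤ n := by exact_mod_cast hn
  have hcn : 0 < c * n := by positivity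
  have e : ∀ s : ℝ, (n * s ^ 4 + s ^ 3) * Real.exp (-(c * n * s ^ 2)) =
      n * (s ^ 4 * Real.exp (-(c * n * s ^ 2))) + s ^ 3 * Real.exp (-(c * n * s ^ 2)) :=
    fun s => by ring
  simp_rw [e]
  have i1 := (integrableOn_pow_mul_exp 4 hcn).const_mul (n : ℝ)
  have i2 := integrableOn_pow_mul_exp 3 hcn
  refine ⟨i1.add i2, ?_⟩
  rw [integral_add i1 i2, integral_const_mul, integral_pow_mul_exp 4 hcn,
    integral_pow_mul_exp 3 hcn, Real.mul_rpow hc.le hn0.le, Real.mul_rpow hc.le hn0.le]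
  have h1 : (n : ℝ) * (n : ℝ) ^ (-((4 : ℕ) + 1 : ℝ) / 2) = (n : ℝ) ^ (-(3 / 2) : ℝ) := by
    rw [← Real.rpow_one_add' hn0.le (by norm_num)]
    norm_num
  have h2 : (n : ℝ) ^ (-((3 : ℕ) + 1 : ℝ) / 2) ≤ (n : ℝ) ^ (-(3 / 2) : ℝ) :=
    Real.rpow_le_rpow_of_exponent_le hn1 (by norm_num)
  calc _ = A * ((n : ℝ) * (n : ℝ) ^ (-((4 : ℕ) + 1 : ℝ) / 2)) +
        B * (n : ℝ) ^ (-((3 : ℕ) + 1 : ℝ) / 2) := by rw [hA, hB]; ring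
    _ ≤ A * (n : ℝ) ^ (-(3 / 2) : ℝ) + B * (n : ℝ) ^ (-(3 / 2) : ℝ) := by
        rw [h1]; gcongr
    _ = _ := by ring

/-- The contribution of all frequencies, cut at the small radius `s₀` and the large radius `R`. -/
lemma integral_kernel_mul_le {k Δ : ℂ → ℂ} (hk : Continuous k) (hΔ : Continuous Δ) {D C c s₀ : ℝ}
    (hD : 0 < D) (hC : 0 < C) (hkD : ∀ η, ‖k η‖ ≤ D)
    (hkD4 : ∀ η, ‖η‖ ^ 4 * ‖k η‖ ≤ D) {F : ℝ → C(𝕋, ℂ)}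
    (hF : ∀ (s : ℝ) (α : 𝕋), Δ (s * phase α) = F s α) {n : ℕ} (hn : 1 ≤ n)
    (hlow : ∀ s, 0 ≤ s → s ≤ s₀ →
      l2 (F s) ≤ C * (n * s ^ 3 + s ^ 2) * Real.exp (-(c * n * s ^ 2)))
    {E R : ℝ} (hR : 1 ≤ R) (hE : 0 ≤ E) (hmid : ∀ s, s₀ ≤ s → s ≤ R → l2 (F s) ≤ C * E)
    (hhigh : ∀ s, l2 (F s) ≤ C) {K : ℝ} (hK : ∀ n : ℕ, 1 ≤ n →
      IntegrableOn (fun s : ℝ => (n * s ^ 4 + s ^ 3) * Real.exp (-(c * n * s ^ 2))) (Set.Ioi 0) ∧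
      ∫ s in Set.Ioi (0 : ℝ), (n * s ^ 4 + s ^ 3) * Real.exp (-(c * n * s ^ 2)) ≤
        K * (n : ℝ) ^ (-(3 / 2) : ℝ)) {δ : ℝ} (hδ : 0 < δ) :
    ∫ η, ‖k (δ • η)‖ * ‖Δ η‖ ≤
      3 * D * C * (K * (n : ℝ) ^ (-(3 / 2) : ℝ) + R ^ 2 * E + (δ ^ 4)⁻¹ * (R ^ 2)⁻¹) := by
  obtain ⟨hi1, hI1⟩ := hK n hn
  have hR0 : 0 < R := by linarith
  -- `G₁`, `G₂`, `G₃` dominate the low, middle and high ranges, Jacobian included; `G₃` comes from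
  -- `s · (δ s)⁻⁴`.
  set G₁ : ℝ → ℝ := fun s => (n * s ^ 4 + s ^ 3) * Real.exp (-(c * n * s ^ 2)) with hG₁
  set G₂ : ℝ → ℝ := (Set.Ioc 0 R).indicator fun _ => R * E with hG₂
  set G₃ : ℝ → ℝ := (Set.Ioi R).indicator fun s => (δ ^ 4)⁻¹ * s ^ (-3 : ℝ) with hG₃
  have hi2 : IntegrableOn G₂ (Set.Ioi 0) :=
    ((integrable_indicator_iff measurableSet_Ioc).mpr (integrableOn_const (by simp))).integrableOn
  have hi3 : IntegrableOn G₃ (Set.Ioi 0) :=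
    ((integrable_indicator_iff measurableSet_Ioi).mpr
      ((integrableOn_Ioi_rpow_of_lt (by norm_num) hR0).const_mul _)).integrableOn
  have hI2 : ∫ s in Set.Ioi (0 : ℝ), G₂ s = R ^ 2 * E := by
    rw [hG₂, setIntegral_indicator measurableSet_Ioc,
      Set.inter_eq_self_of_subset_right Set.Ioc_subset_Ioi_self, setIntegral_const]
    simp [hR0.le]
    ring
  have hI3 : ∫ s in Set.Ioi (0 : ℝ), G₃ s ≤ (δ ^ 4)⁻¹ * (R ^ 2)⁻¹ := by
    rw [hG₃, setIntegral_indicator measurableSet_Ioi,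
      Set.inter_eq_self_of_subset_right (Set.Ioi_subset_Ioi hR0.le), integral_const_mul,
      integral_Ioi_rpow_of_lt (by norm_num) hR0]
    have h1 : R ^ (-3 + 1 : ℝ) = (R ^ 2)⁻¹ := by
      rw [show (-3 + 1 : ℝ) = -((2 : ℕ) : ℝ) by norm_num, Real.rpow_neg hR0.le, Real.rpow_natCast]
    rw [h1]
    have h2 : 0 ≤ (R ^ 2)⁻¹ := by positivity
    refine mul_le_mul_of_nonneg_left ?_ (by positivity)
    rw [show (-3 + 1 : ℝ) = -2 by norm_num, neg_div_neg_eq]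
    linarith
  have hnn1 : ∀ s, 0 < s → 0 ≤ G₁ s := fun s hs => by simp only [hG₁]; positivity
  have hnn2 : ∀ s, 0 ≤ G₂ s := fun s => Set.indicator_nonneg (fun _ _ => by positivity) s
  have hnn3 : ∀ s, 0 ≤ G₃ s := fun s => Set.indicator_nonneg (fun t ht => by
    have : 0 < t := hR0.trans ht
    positivity) s
  have hDC : 0 ≤ 3 * D * C := by positivity
  have hmain : ∫ η, ‖k (δ • η)‖ * ‖Δ η‖ ≤
      ∫ s in Set.Ioi (0 : ℝ), 3 * D * C * (G₁ s + G₂ s + G₃ s) := by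
    refine integral_le_of_circle_integral_le (by fun_prop) (fun η => by positivity)
      (((hi1.add hi2).add hi3).const_mul _)
      (fun s hs => mul_nonneg hDC (add_nonneg (add_nonneg (hnn1 s hs) (hnn2 s)) (hnn3 s))) ?_
    intro s hs
    have hcirc : ∀ B : ℝ, 0 ≤ B → (∀ α : 𝕋, ‖k (δ • (s * phase α))‖ ≤ B) →
        ∫ α : 𝕋, ‖k (δ • (s * phase α))‖ * ‖Δ (s * phase α)‖ ≤ B * (3 * l2 (F s)) := by
      intro B hB0 hB
      have h1 : ∫ α : 𝕋, ‖k (δ • (s * phase α))‖ * ‖Δ (s * phase α)‖ ≤ ∫ α : 𝕋, B * ‖F s α‖ := by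
        refine integral_mono (integrable_circle (by fun_prop)) (integrable_circle (by fun_prop))
          fun α => ?_
        simp only
        rw [hF]
        exact mul_le_mul_of_nonneg_right (hB α) (norm_nonneg _)
      rw [integral_const_mul] at h1
      exact h1.trans (mul_le_mul_of_nonneg_left (integral_norm_le_l2 _) hB0)
    have hD' := hcirc D hD.le fun α => hkD _
    have g1 := hnn1 s hs
    have g2 := hnn2 s
    have g3 := hnn3 s
    rcases le_or_gt s s₀ with h | h
    · have h1 := hlow s hs.le h
      calc _ ≤ s * (D * (3 * (C * (n * s ^ 3 + s ^ 2) * Real.exp (-(c * n * s ^ 2))))) := by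
            gcongr; exact hD'.trans (by gcongr)
        _ = 3 * D * C * G₁ s := by simp only [hG₁]; ring
        _ ≤ _ := mul_le_mul_of_nonneg_left (by linarith) hDC
    rcases le_or_gt s R with hsR | hsR
    · have h1 := hmid s h.le hsR
      have h2 : G₂ s = R * E := Set.indicator_of_mem (show s ∈ Set.Ioc 0 R from ⟨hs, hsR⟩) _
      calc _ ≤ s * (D * (3 * (C * E))) := by gcongr; exact hD'.trans (by gcongr)
        _ ≤ R * (D * (3 * (C * E))) := by gcongr
        _ = 3 * D * C * G₂ s := by rw [h2]; ring
        _ ≤ _ := mul_le_mul_of_nonneg_left (by linarith) hDC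
    · have h1 := hhigh s
      have h2 : G₃ s = (δ ^ 4)⁻¹ * s ^ (-3 : ℝ) :=
        Set.indicator_of_mem (show s ∈ Set.Ioi R from hsR) _
      have h3 : s ^ (-3 : ℝ) = (s ^ 3)⁻¹ := by
        rw [show (-3 : ℝ) = -((3 : ℕ) : ℝ) by norm_num, Real.rpow_neg hs.le, Real.rpow_natCast]
      have h4 := hcirc (D * ((δ * s) ^ 4)⁻¹) (by positivity) fun α => by
        have h5 := hkD4 (δ • (s * phase α))
        rw [norm_smul, norm_mul, norm_phase, mul_one, Complex.norm_real,
          Real.norm_of_nonneg hδ.le, Real.norm_of_nonneg hs.le] at h5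
        rw [← div_eq_mul_inv, le_div_iff₀ (by positivity)]
        linarith
      calc _ ≤ s * (D * ((δ * s) ^ 4)⁻¹ * (3 * C)) := by gcongr; exact h4.trans (by gcongr)
        _ = 3 * D * C * G₃ s := by rw [h2, h3]; field_simp
        _ ≤ _ := mul_le_mul_of_nonneg_left (by linarith) hDC
  refine hmain.trans ?_
  have hadd₁ := integral_add (hi1.add hi2) hi3
  have hadd₂ := integral_add hi1 hi2
  simp only [Pi.add_apply] at hadd₁ hadd₂
  rw [integral_const_mul, hadd₁, hadd₂]
  exact mul_le_mul_of_nonneg_left (by linarith) hDC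

/-- Stretched exponentials beat powers. -/
lemma exists_sq_mul_exp_neg_le {γ : ℝ} (hγ : 0 < γ) : ∃ C : ℝ, 0 < C ∧ ∀ x : ℝ, 1 ≤ x →
    x ^ 2 * Real.exp (-(γ * x ^ (1 / 3 : ℝ))) ≤ C * x ^ (-(3 / 2) : ℝ) := by
  refine ⟨(Nat.factorial 12 : ℕ) / γ ^ 12, by positivity, fun x hx => ?_⟩
  have hx0 : 0 < x := by linarith
  -- The twelfth power of `x^{1/3}` is `x⁴`, which leaves `x⁻²`.
  have h1 := Real.pow_div_factorial_le_exp (γ * x ^ (1 / 3 : ℝ)) (by positivity) 12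
  have h2 : (x ^ (1 / 3 : ℝ)) ^ 12 = x ^ 4 := by
    rw [← Real.rpow_natCast, ← Real.rpow_mul hx0.le, ← Real.rpow_natCast]
    norm_num
  rw [mul_pow, h2] at h1
  have h3 : x ^ (-(2 : ℝ)) ≤ x ^ (-(3 / 2) : ℝ) :=
    Real.rpow_le_rpow_of_exponent_le hx (by norm_num)
  have h4 : x ^ (-(2 : ℝ)) = (x ^ 2)⁻¹ := by
    rw [Real.rpow_neg hx0.le]; norm_num
  rw [Real.exp_neg]
  calc x ^ 2 * (Real.exp (γ * x ^ (1 / 3 : ℝ)))⁻¹ ≤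
      x ^ 2 * (γ ^ 12 * x ^ 4 / (Nat.factorial 12 : ℕ))⁻¹ := by gcongr
    _ = (Nat.factorial 12 : ℕ) / γ ^ 12 * (x ^ 2)⁻¹ := by field_simp
    _ ≤ _ := by rw [← h4]; gcongr

end RadialIntegrals

/-! ### The local limit theorem -/

section LocalLimit

local notation "𝕋" => AddCircle (2 * Real.pi)

variable {μ : PMF rigidMotions}

lemma charFun_gaussian (σ : ℝ) (n : ℕ) (t : ℂ) :
    charFun ((stdGaussian ℂ).map fun z => (σ * √n) • z) t =
      (Real.exp (-(σ ^ 2 / 2 * ‖t‖ ^ 2) * n) : ℂ) := by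
  rw [charFun_map_smul, charFun_stdGaussian, norm_smul, Real.norm_eq_abs, Complex.ofReal_exp]
  congr 1
  have h : (|σ * √n| * ‖t‖) ^ 2 = σ ^ 2 * n * ‖t‖ ^ 2 := by
    rw [mul_pow, sq_abs, mul_pow, Real.sq_sqrt n.cast_nonneg]
  have h' := congrArg (fun x : ℝ => (x : ℂ)) h
  push_cast at h' ⊢
  rw [h']
  ring

lemma charFun_sub_eq_charDiff (hfin : μ.support.Finite) (n : ℕ) (s : ℝ) (α : 𝕋) :
    charFun (walkLaw μ n).toMeasure (s * phase α) -
      charFun ((stdGaussian ℂ).map fun z => (sigma μ * √n) • z) (s * phase α) =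
      charDiff hfin.toFinset (fun g => (μ g).toReal) n s α := by
  rw [charFun_walkLaw hfin, charFun_gaussian, charDiff, ← sigma_sq_eq hfin, norm_mul, norm_phase,
    mul_one, Complex.norm_real, Real.norm_eq_abs, sq_abs]
  simp

lemma integral_exp_neg_mul_norm_sq {b : ℝ} (hb : 0 < b) :
    ∫ η : ℂ, Real.exp (-b * ‖η‖ ^ 2) = Real.pi / b := by
  rw [GaussianFourier.integral_rexp_neg_mul_sq_norm hb, Complex.finrank_real_complex]
  norm_num

/-- The smoothed Gaussian has density `O(1/n)`. -/
lemma integral_kernel_mul_gaussian_le {k : ℂ → ℂ} {D σ : ℝ} (hσ : 0 < σ ^ 2)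
    (hkD : ∀ η, ‖k η‖ ≤ D) {n : ℕ} (hn : 1 ≤ n) (δ : ℝ) :
    ∫ η, ‖k (δ • η)‖ * ‖charFun ((stdGaussian ℂ).map fun z => (σ * √n) • z) η‖ ≤
      D * (2 * Real.pi / (σ ^ 2 * n)) := by
  have hn0 : (0 : ℝ) < n := by exact_mod_cast hn
  have hb : 0 < σ ^ 2 / 2 * n := by positivity
  have hI := integral_exp_neg_mul_norm_sq hb
  have hint : Integrable fun η : ℂ => Real.exp (-(σ ^ 2 / 2 * n) * ‖η‖ ^ 2) := by
    apply Integrable.of_integral_ne_zero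
    rw [hI]
    have := Real.pi_pos
    positivity
  calc _ ≤ ∫ η : ℂ, D * Real.exp (-(σ ^ 2 / 2 * n) * ‖η‖ ^ 2) := by
        refine integral_mono_of_nonneg (ae_of_all _ fun η => by positivity) (hint.const_mul D)
          (ae_of_all _ fun η => ?_)
        simp only
        rw [charFun_gaussian, Complex.norm_real, Real.norm_of_nonneg (Real.exp_pos _).le]
        have e : -(σ ^ 2 / 2 * ‖η‖ ^ 2) * (n : ℝ) = -(σ ^ 2 / 2 * n) * ‖η‖ ^ 2 := by ring
        rw [e]
        exact mul_le_mul_of_nonneg_right (hkD _) (Real.exp_pos _).le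
    _ = _ := by
        rw [integral_const_mul, hI]
        field_simp

/-- With frequencies cut at `R = exp (β n^{1/3})`, both the middle and the high range are
negligible. -/
lemma middle_and_high_range_le {c β : ℝ} (hc : 0 < c) (hβ : 0 < β) (hβ1 : β ≤ 1)
    (hβc : β ≤ c / 16) {n : ℕ} (hn : 2 ≤ n) {r : ℝ}
    (hr : Real.exp (-(β / 12) * (n : ℝ) ^ (1 / 3 : ℝ) / Real.log n ^ 2) < r) :
    Real.exp (β * (n : ℝ) ^ (1 / 3 : ℝ)) ^ 2 *
        Real.exp (-(c * n / (1 + Real.log (Real.exp (β * (n : ℝ) ^ (1 / 3 : ℝ)))) ^ 2)) +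
      ((r / √n) ^ 4)⁻¹ * (Real.exp (β * (n : ℝ) ^ (1 / 3 : ℝ)) ^ 2)⁻¹ ≤
      2 * ((n : ℝ) ^ 2 * Real.exp (-(β * (n : ℝ) ^ (1 / 3 : ℝ)))) := by
  have hn2 : (2 : ℝ) ≤ n := by exact_mod_cast hn
  have hn0 : (0 : ℝ) < n := by linarith
  set L : ℝ := (n : ℝ) ^ (1 / 3 : ℝ) with hL
  have hL1 : 1 ≤ L := Real.one_le_rpow (by linarith) (by norm_num)
  have hL0 : 0 < L := by linarith
  have hL3 : (n : ℝ) = L ^ 3 := by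
    rw [hL, ← Real.rpow_natCast, ← Real.rpow_mul hn0.le]
    norm_num
  have hr0 : 0 < r := (Real.exp_pos _).trans hr
  have hsq : Real.exp (β * L) ^ 2 = Real.exp (2 * (β * L)) := by
    rw [← Real.exp_nat_mul]; norm_num
  have h1 : Real.exp (β * L) ^ 2 * Real.exp (-(c * n / (1 + Real.log (Real.exp (β * L))) ^ 2)) ≤
      (n : ℝ) ^ 2 * Real.exp (-(β * L)) := by
    -- `1 + β L ≤ 2 L` and `n = L³`. As `3 β ≤ c / 4`, the gap then beats `R² = exp (2 β L)` with
    -- `exp (-β L)` to spare.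
    have h2 : c / 4 * L ≤ c * n / (1 + Real.log (Real.exp (β * L))) ^ 2 := by
      rw [Real.log_exp, le_div_iff₀ (by positivity)]
      have h3 : (1 + β * L) ^ 2 ≤ (2 * L) ^ 2 := pow_le_pow_left₀ (by positivity) (by nlinarith) 2
      calc c / 4 * L * (1 + β * L) ^ 2 ≤ c / 4 * L * (2 * L) ^ 2 := by gcongr
        _ = c * n := by rw [hL3]; ring
    calc _ ≤ Real.exp (-(β * L)) := by
          rw [hsq, ← Real.exp_add]
          apply Real.exp_le_exp.mpr
          nlinarith
      _ ≤ _ := le_mul_of_one_le_left (Real.exp_pos _).le (one_le_pow₀ (by linarith))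
  have h2 : ((r / √n) ^ 4)⁻¹ * (Real.exp (β * L) ^ 2)⁻¹ ≤ (n : ℝ) ^ 2 * Real.exp (-(β * L)) := by
    have h3 : Real.exp (-(β * L)) ≤ r ^ 4 := by
      -- `log² n ≥ 1/3` turns the rate `β / 12` into `β / 4`, so `r⁻⁴` uses up only half of the
      -- decay of `R⁻²`.
      have h4 : Real.exp (-(β / 4 * L)) ≤ r := by
        refine le_trans (Real.exp_le_exp.mpr ?_) hr.le
        have h5 : (1 : ℝ) / 3 ≤ Real.log n ^ 2 := by
          have h6 : Real.log 2 ≤ Real.log n := Real.log_le_log two_pos hn2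
          nlinarith [Real.log_two_gt_d9]
        rw [le_div_iff₀ (by linarith)]
        have h7 : 0 ≤ β / 4 * L := by positivity
        nlinarith
      calc Real.exp (-(β * L)) = Real.exp (-(β / 4 * L)) ^ 4 := by
            rw [← Real.exp_nat_mul]; congr 1; push_cast; ring
        _ ≤ r ^ 4 := pow_le_pow_left₀ (Real.exp_pos _).le h4 4
    have h4 : (√(n : ℝ)) ^ 4 = (n : ℝ) ^ 2 := by
      rw [show 4 = 2 * 2 from rfl, pow_mul, Real.sq_sqrt hn0.le]
    rw [div_pow, h4, inv_div, hsq, div_mul_eq_mul_div, div_le_iff₀ (by positivity), mul_assoc]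
    refine mul_le_mul_of_nonneg_left ?_ (sq_nonneg _)
    calc (Real.exp (2 * (β * L)))⁻¹ = Real.exp (-(β * L)) * Real.exp (-(β * L)) := by
          rw [← Real.exp_neg, ← Real.exp_add]; congr 1; ring
      _ ≤ Real.exp (-(β * L)) * r ^ 4 := by gcongr
  linarith

/-- The local limit theorem for a walk satisfying the arithmetic hypothesis. -/
theorem exists_local_limit (hfin : μ.support.Finite) {g₀ : rigidMotions}
    (H : IsGenericWalk hfin.toFinset (fun g => (μ g).toReal) g₀) :
    ∃ c : ℝ, 0 < c ∧ ∃ C : ℝ, 0 < C ∧ ∀ N : ℕ, 2 ≤ N → ∀ (x₀ : ℂ) (r : ℝ),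
      Real.exp (-c * (N : ℝ) ^ (1 / 3 : ℝ) / Real.log N ^ 2) < r →
      |(walkLaw μ N).toMeasure.real (Metric.ball x₀ r) -
          ((stdGaussian ℂ).map fun z => (sigma μ * √N) • z).real (Metric.ball x₀ r)|
        ≤ C * (N : ℝ) ^ (-(3 / 2) : ℝ) * r ^ 2 := by
  obtain ⟨c, hc, C, hC, s₀, -, -, hlow, hmid, hhigh⟩ := H.exists_l2_charDiff_le
  obtain ⟨κ, k, D, hκ, hκ0, hκsupp, hκint, ⟨M, hM⟩, hk, hki, hD, hkD, hkD4, hrep⟩ := exists_kernel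
  obtain ⟨K, hK, hKint⟩ := exists_lowFrequency_integral_le hc
  set β : ℝ := min 1 (c / 16) with hβdef
  have hβ : 0 < β := lt_min one_pos (by positivity)
  obtain ⟨J, hJ, hJle⟩ := exists_sq_mul_exp_neg_le hβ
  have hσ : 0 < sigma μ ^ 2 := by rw [sigma_sq_eq hfin]; exact H.variance_pos
  have hpi := Real.pi_pos
  refine ⟨β / 12, by positivity,
    3 * D * C * (K + 2 * J) * (4 * Real.pi) + D * (2 * Real.pi / sigma μ ^ 2) * (4 * Real.pi),
    by positivity, ?_⟩
  intro N hN x₀ r hr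
  have hN1 : 1 ≤ N := by omega
  have hN1' : (1 : ℝ) ≤ N := by exact_mod_cast hN1
  have hN0 : (0 : ℝ) < N := by linarith
  have hr0 : 0 < r := (Real.exp_pos _).trans hr
  have hsN : 1 ≤ √(N : ℝ) := Real.one_le_sqrt.mpr hN1'
  -- With Gaussian density `O(1/N)`, the edge term `r δ / N` is then exactly of order `N^{-3/2} r²`.
  set δ : ℝ := r / √N with hδdef
  have hδ : 0 < δ := by positivity
  have hδr : δ ≤ r := div_le_self hr0.le hsN
  set R : ℝ := Real.exp (β * (N : ℝ) ^ (1 / 3 : ℝ)) with hR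
  have hR1 : 1 ≤ R := Real.one_le_exp (by positivity)
  have hrange := middle_and_high_range_le hc hβ (min_le_left _ _) (min_le_right _ _) hN hr
  have hJN := hJle N hN1'
  have : IsProbabilityMeasure ((stdGaussian ℂ).map fun z => (sigma μ * √N) • z) :=
    Measure.isProbabilityMeasure_map (by fun_prop)
  have hfreq := integral_kernel_mul_le hk
    (Δ := fun η => charFun (walkLaw μ N).toMeasure η -
      charFun ((stdGaussian ℂ).map fun z => (sigma μ * √N) • z) η)
    (continuous_charFun.sub continuous_charFun) hD hC hkD hkD4
    (fun s α => charFun_sub_eq_charDiff hfin N s α) hN1 (hlow N) hR1 (Real.exp_pos _).le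
    (fun s hs hsR => hmid N R s hs hsR hR1) (hhigh N) hKint hδ
  have hkδ : Integrable fun η : ℂ => k (δ • η) :=
    (integrable_comp_smul_iff volume k hδ.ne').mpr hki
  have hrepδ := fun x => scaled_kernel_representation hrep hδ x
  have hball := abs_real_ball_sub_le (κ := fun x => (δ ^ 2)⁻¹ * κ (δ⁻¹ • x)) (δ := δ)
    (M := (δ ^ 2)⁻¹ * M) (by fun_prop)
    (fun x => by
      rw [norm_mul, Real.norm_of_nonneg (by positivity)]
      exact mul_le_mul_of_nonneg_left (hM _) (by positivity))
    (fun x => mul_nonneg (by positivity) (hκ0 _))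
    (fun x hx => by
      rw [hκsupp, mul_zero]
      rw [norm_smul, norm_inv, Real.norm_of_nonneg hδ.le, ← div_eq_inv_mul]
      exact (one_le_div hδ).mpr hx)
    (integral_scaled_kernel hκint hδ) (walkLaw μ N).toMeasure
    ((stdGaussian ℂ).map fun z => (sigma μ * √N) • z)
    (fun w => (abs_smoothed_sub_le hkδ hrepδ _ _ w).trans hfreq)
    (fun w => (smoothed_le hkδ hrepδ _ w).trans
      (integral_kernel_mul_gaussian_le hσ hkD hN1 δ)) x₀ hδ.le hδr
  refine hball.trans ?_
  have hpow : (N : ℝ) ^ (-(3 / 2) : ℝ) = ((N : ℝ) * √N)⁻¹ := by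
    rw [Real.rpow_neg hN0.le, Real.sqrt_eq_rpow, ← Real.rpow_one_add' hN0.le (by norm_num)]
    norm_num
  set P : ℝ := (N : ℝ) ^ (-(3 / 2) : ℝ) with hP
  have ha : 3 * D * C * (K * P + R ^ 2 * Real.exp (-(c * N / (1 + Real.log R) ^ 2)) +
      (δ ^ 4)⁻¹ * (R ^ 2)⁻¹) ≤ 3 * D * C * ((K + 2 * J) * P) := by
    refine mul_le_mul_of_nonneg_left ?_ (by positivity)
    linarith
  have hb : D * (2 * Real.pi / (sigma μ ^ 2 * N)) * (4 * Real.pi * r * δ) =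
      D * (2 * Real.pi / sigma μ ^ 2) * (4 * Real.pi) * P * r ^ 2 := by
    rw [hpow, hδdef]
    field_simp
  have h4 := mul_le_mul_of_nonneg_right ha (show 0 ≤ 4 * Real.pi * r ^ 2 by positivity)
  rw [hb]
  linarith

end LocalLimit

end PlaneWalk

end

theorem theorem2 (μ : PMF PlaneWalk.rigidMotions)
    (hfin : μ.support.Finite)
    (hsymm : PlaneWalk.IsSymmetric μ)
    (hdrift : PlaneWalk.drift μ = 0)
    (hcos : ∃ g ∈ μ.support,
      (∃ q : ℚ, Real.cos (PlaneWalk.angle g) = q) ∧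
      ∀ k : ℤ, Real.cos (PlaneWalk.angle g) ≠ k / 2) :
    ∃ c : ℝ, 0 < c ∧ ∃ C : ℝ, 0 < C ∧ ∀ N : ℕ, 2 ≤ N → ∀ (x₀ : ℂ) (r : ℝ),
      Real.exp (-c * (N : ℝ) ^ (1 / 3 : ℝ) / Real.log N ^ 2) < r →
      |(PlaneWalk.walkLaw μ N).toMeasure.real (Metric.ball x₀ r) -
          (stdGaussian ℂ).real
            {z : ℂ | (PlaneWalk.sigma μ * Real.sqrt N) • z ∈ Metric.ball x₀ r}|
        ≤ C * (N : ℝ) ^ (-(3 / 2) : ℝ) * r ^ 2 := by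
  by_cases hne : ∃ g ∈ μ.support, PlaneWalk.trans g ≠ 0
  · obtain ⟨g₀, hg₀, hq, hhalf⟩ := hcos
    obtain ⟨c, hc, C, hC, h⟩ := PlaneWalk.exists_local_limit hfin
      (PlaneWalk.isGenericWalk_of_pmf hfin hsymm hdrift hg₀ hq hhalf hne)
    refine ⟨c, hc, C, hC, fun N hN x₀ r hr => ?_⟩
    have h1 := h N hN x₀ r hr
    rwa [map_measureReal_apply (by fun_prop) Metric.isOpen_ball.measurableSet] at h1
  -- Every step fixes `0` and `σ = 0`: the two laws coincide, so any constants do.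
  · push Not at hne
    refine ⟨1, one_pos, 1, one_pos, fun N _ x₀ r _ => ?_⟩
    rw [PlaneWalk.walkLaw_eq_pure_zero hne, PlaneWalk.sigma_eq_zero hne, PMF.toMeasure_pure]
    simp only [zero_mul, zero_smul]
    have h0 : (Measure.dirac (0 : ℂ)).real (Metric.ball x₀ r) =
        (stdGaussian ℂ).real {_z : ℂ | (0 : ℂ) ∈ Metric.ball x₀ r} := by
      by_cases h : (0 : ℂ) ∈ Metric.ball x₀ r
      · simp only [h, Set.ofPred_true, probReal_univ]
        rw [Measure.real, Measure.dirac_apply_of_mem h, ENNReal.toReal_one]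
      · simp only [h, Set.ofPred_false, measureReal_empty]
        rw [Measure.real, Measure.dirac_apply' _ Metric.isOpen_ball.measurableSet,
          Set.indicator_of_notMem h, ENNReal.toReal_zero]
    rw [h0, sub_self, abs_zero]
    positivity
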